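/- For $n\ge 1$ let $B_n$ be the set of signed permutations of $[n]=\{1,\dots,n\}$, i.e. bijections $\sigma$ of $\{\pm1,\dots,\pm n\}$ with $\sigma(-i)=-\sigma(i)$, and write $\sigma_i=\sigma(i)$ for $i\in[n]$. Let $B_n^*$ be the set of $\sigma\in B_n$ with $\sigma_i\ne i$ for all $i\in[n]$. Put $\mathsf{neg}(\sigma)=\#\{i\in[n]:\sigma_i<0\}$, $\mathsf{wex}(\sigma)=\#\{i\in[n]:\sigma_i\ge i\}$ and $\mathsf{fwex}(\sigma)=2\,\mathsf{wex}(\sigma)+\mathsf{neg}(\sigma)$, and let $D_n^*$ be the set of $\sigma\in B_n^*$ with $\mathsf{neg}(\sigma)$ even. Let $\mathsf{cro}_B(\sigma)$ be the number of pairs $(i,j)\in[n]\times[n]$ such that $i<j\le\sigma_i<\sigma_j$, or $-i<j\le-\sigma_i<\sigma_j$, or $i>j>\sigma_i>\sigma_j$. Let $D$ be the $q$-derivative on polynomials in $t$, $(Df)(t)=\frac{f(qt)-f(t)}{(q-1)t}$, i.e. the linear map with $D(t^k)=(1+q+\cdots+q^{k-1})\,t^{k-1}$ (which also makes sense at $q=1$),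 let $U$ be multiplication by $t$, and let $Q_n(t,q)=(D+UDU)^n 1$. Then the following identities of polynomials in $t$ hold, for $q$ an indeterminate and, more generally, for $q$ any unit of any commutative ring: (i) $\displaystyle\sum_{\sigma\in B_n^*}\left(-\frac1q\right)^{\lfloor \mathsf{fwex}(\sigma)/2\rfloor}t^{\mathsf{neg}(\sigma)}q^{\mathsf{cro}_B(\sigma)}=\left(-\frac1q\right)^{\lfloor n/2\rfloor}Q_n(t,q)$; (ii) $\displaystyle\sum_{\sigma\in D_n^*}\left(-\frac1q\right)^{\lfloor \mathsf{fwex}(\sigma)/2\rfloor}t^{\mathsf{neg}(\sigma)}q^{\mathsf{cro}_B(\sigma)}$ equals $\left(-\frac1q\right)^{n/2}Q_n(t,q)$ if $n$ is even, and $0$ if $n$ is odd. -/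

import Mathlib

open Polynomial

/-- The set `[±n] = {-n, …, -1, 1, …, n}`. -/
abbrev PM (n : ℕ) : Type := {z : ℤ // z ∈ (Finset.Icc (-(n : ℤ)) (n : ℤ)).erase 0}

instance PM.instNeg (n : ℕ) : Neg (PM n) where
  neg i := ⟨-i.1, by
    have h := i.2
    simp only [Finset.mem_erase, Finset.mem_Icc] at h ⊢
    omega⟩

/-- The set `B_n` of signed permutations of `[n]`: the bijections `σ` of `[±n]` onto itself
with `σ (-i) = -σ i`. -/
abbrev SignedPerm (n : ℕ) : Type := {σ : Equiv.Perm (PM n) // ∀ i, σ (-i) = -σ i}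

namespace SignedPerm

variable {n : ℕ}

/-- The value `σ_i = σ(i)`, as an integer. -/
def val (σ : SignedPerm n) (i : PM n) : ℤ := (σ.1 i).1

/-- `neg(σ)`: the number of `i ∈ [n]` with `σ_i < 0`. -/
noncomputable def neg (σ : SignedPerm n) : ℕ :=
  (Finset.univ.filter fun i : PM n => 0 < i.1 ∧ σ.val i < 0).card

/-- `wex(σ)`: the number of `i ∈ [n]` with `σ_i ≥ i`. -/
noncomputable def wex (σ : SignedPerm n) : ℕ :=
  (Finset.univ.filter fun i : PM n => 0 < i.1 ∧ i.1 ≤ σ.val i).card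

/-- `fwex(σ) = 2 wex(σ) + neg(σ)`. -/
noncomputable def fwex (σ : SignedPerm n) : ℕ := 2 * σ.wex + σ.neg

/-- The pair `(i, j)`, where `i, j ∈ [n]`, is a crossing of `σ`. -/
def IsCrossing (σ : SignedPerm n) (i j : PM n) : Prop :=
  0 < i.1 ∧ 0 < j.1 ∧
    ((i.1 < j.1 ∧ j.1 ≤ σ.val i ∧ σ.val i < σ.val j) ∨
     (-i.1 < j.1 ∧ j.1 ≤ -σ.val i ∧ -σ.val i < σ.val j) ∨
     (i.1 > j.1 ∧ j.1 > σ.val i ∧ σ.val i > σ.val j))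

instance instDecidableIsCrossing (σ : SignedPerm n) (i j : PM n) : Decidable (σ.IsCrossing i j) :=
  inferInstanceAs (Decidable (_ ∧ _ ∧ _))

/-- `cro_B(σ)`: the number of crossings of `σ`. -/
noncomputable def cro (σ : SignedPerm n) : ℕ :=
  (Finset.univ.filter fun p : PM n × PM n => σ.IsCrossing p.1 p.2).card

/-- `B_n^*`: the signed permutations without fixed points, a fixed point being an
`i ∈ [n]` with `σ_i = i`. -/
noncomputable def Bstar (n : ℕ) : Finset (SignedPerm n) :=
  Finset.univ.filter fun σ => ∀ i : PM n, 0 < i.1 → σ.val i ≠ i.1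

/-- `D_n^*`: the members of `B_n^*` with an even number of negative entries. -/
noncomputable def Dstar (n : ℕ) : Finset (SignedPerm n) :=
  (Bstar n).filter fun σ => Even σ.neg

end SignedPerm

section QDerivative

variable {R : Type*} [CommRing R]

/-- The `q`-derivative `D` on polynomials in `t` (the variable `X` of `R[X]`), the linear map with
`D (t ^ n) = [n]_q t ^ (n - 1)`, where `[n]_q = 1 + q + ⋯ + q ^ (n - 1)`. By `qDeriv_spec` and
`qDeriv_eq_of_mul_eq` it is the quotient `(f(qt) - f(t)) / ((q - 1) t)`; this form makes sense
for every `q`, including `q = 1`. -/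
noncomputable def qDeriv (q : R) : Module.End R R[X] :=
  Polynomial.lsum fun n => (∑ i ∈ Finset.range n, q ^ i) • Polynomial.monomial (n - 1)

theorem qDeriv_monomial (q : R) (n : ℕ) (a : R) :
    qDeriv q (monomial n a) = monomial (n - 1) ((∑ i ∈ Finset.range n, q ^ i) * a) := by
  simp [qDeriv, Polynomial.lsum_apply, Polynomial.sum_monomial_index, smul_monomial]

/-- `(q - 1) t (D f)(t) = f(qt) - f(t)`. -/
theorem qDeriv_spec (q : R) (f : R[X]) :
    C (q - 1) * X * qDeriv q f = f.comp (C q * X) - f := by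
  induction f using Polynomial.induction_on' with
  | add f g hf hg => rw [map_add, mul_add, hf, hg, add_comp]; ring
  | monomial n a =>
    rw [qDeriv_monomial, monomial_comp]
    cases n with
    | zero => simp
    | succ n =>
      have h := mul_geom_sum q (n + 1)
      rw [Nat.add_sub_cancel, mul_assoc, X_mul_monomial, C_mul_monomial, ← mul_assoc, h, mul_pow,
        ← C_mul_X_pow_eq_monomial, ← C_mul_X_pow_eq_monomial]
      simp only [C_mul, C_sub, C_pow, C_1]
      ring

/-- If `q - 1` is not a zero divisor, then `D f` is the only solution `g` of
`(q - 1) t g(t) = f(qt) - f(t)`. -/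
theorem qDeriv_eq_of_mul_eq (q : R) (hq : q - 1 ∈ nonZeroDivisors R) (f g : R[X])
    (h : C (q - 1) * X * g = f.comp (C q * X) - f) : g = qDeriv q f := by
  rw [← qDeriv_spec] at h
  ext k
  have hk := congrArg (fun p : R[X] => p.coeff (k + 1)) h
  simp only [mul_assoc, coeff_C_mul, coeff_X_mul] at hk
  exact (mul_cancel_left_mem_nonZeroDivisors hq).1 hk

/-- The operator `U`: multiplication by `t`. -/
noncomputable def mulT : Module.End R R[X] := LinearMap.mulLeft R (X : R[X])

/-- `Q_n(t, q) = (D + U D U)^n 1`, a polynomial in `t` for each `q`. -/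
noncomputable def qPoly (q : R) (n : ℕ) : R[X] :=
  ((qDeriv q + mulT * qDeriv q * mulT) ^ n : Module.End R R[X]) 1

end QDerivative

/-! Put `s = -1/q`. The core, `SignedPerm.sum_Bstar`, is that the sum of `s^wex t^neg q^cro` over
`B_n^*` is `(sD + UDU)^n 1`, obtained from a left-to-right scan. A signed permutation is a signed
perfect matching of the points `2, …, 2n+1`, joining position `2i` to value `2|σ_i|+1`. The product
of `weight` over the points is `s^wex t^neg q^cro`, or `0` if there is a fixed point. At an even cut
as many even as odd ends are loose, say `h`, and the total weight of the completions by `m` further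
pairs of points is `D^h (sD + UDU)^m 1` (`fiberSum_even`).

Both sides obey one recurrence. Scanning a pair of points takes `h` to `h+1`, `h`, `h-1` with
coefficients `(s + tq^h)(1 + tq^(h+1))`, `s([h+1] - 1) + tq^h[h+1] + [h](1 + tq^h)`, `[h]^2`. From
`DU = qUD + 1` the operator gives `s + q^(2h+1)t^2`, `tq^h([h] + [h+1])`, `[h]^2`. They agree
because `qs = -1`: the terms linear in `t` cancel in the first, and `s([h+1] - 1) = sq[h] = -[h]`,
where the `-1` is the exclusion of fixed points, in the second.

Finally `⌊fwex/2⌋ = wex + ⌊neg/2⌋`. Since `sD + UDU` reverses the parity of degrees, rescaling `t^k`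
by `s^⌊k/2⌋` turns it into `D + UDU` up to powers of `s` that accumulate to `s^⌊n/2⌋`. Part (ii)
takes the terms of even degree in (i). -/

/-! ### Commutation rules for the q-derivative and the path recurrence -/

section QDerivative

variable {R : Type*} [CommRing R]

/-- The `q`-number `[n]_q = 1 + q + ⋯ + q ^ (n - 1)`. -/
def qNum (q : R) (n : ℕ) : R := ∑ i ∈ Finset.range n, q ^ i

@[simp] theorem qNum_zero (q : R) : qNum q 0 = 0 := by simp [qNum]

theorem qNum_succ (q : R) (n : ℕ) : qNum q (n + 1) = qNum q n + q ^ n := Finset.sum_range_succ _ _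

theorem qNum_succ' (q : R) (n : ℕ) : qNum q (n + 1) = 1 + q * qNum q n := by
  rw [qNum, Finset.sum_range_succ', qNum, Finset.mul_sum]
  simp [pow_succ', add_comm]

theorem qDeriv_X_mul (q : R) (f : R[X]) :
    qDeriv q (X * f) = f + C q * X * qDeriv q f := by
  induction f using Polynomial.induction_on' with
  | add f g hf hg => rw [mul_add, map_add, hf, hg, map_add]; ring
  | monomial n a =>
    rw [X_mul_monomial, qDeriv_monomial, qDeriv_monomial, Nat.add_sub_cancel]
    have h := qNum_succ' q n
    simp only [qNum] at h
    rw [h]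
    cases n with
    | zero => simp
    | succ n =>
      rw [Nat.add_sub_cancel, mul_assoc (C q), X_mul_monomial, C_mul_monomial, ← map_add]
      congr 1; ring

theorem qDeriv_C_mul (q a : R) (f : R[X]) : qDeriv q (C a * f) = C a * qDeriv q f := by
  rw [← smul_eq_C_mul, map_smul, smul_eq_C_mul]

theorem qDeriv_pow_C_mul (q a : R) (h : ℕ) (f : R[X]) :
    (qDeriv q ^ h) (C a * f) = C a * (qDeriv q ^ h) f := by
  rw [← smul_eq_C_mul, map_smul, smul_eq_C_mul]

theorem qDeriv_pow_succ (q : R) (h : ℕ) (f : R[X]) :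
    (qDeriv q ^ (h + 1)) f = qDeriv q ((qDeriv q ^ h) f) := by
  rw [pow_succ', Module.End.mul_apply]

theorem qDeriv_pow_succ' (q : R) (h : ℕ) (f : R[X]) :
    (qDeriv q ^ (h + 1)) f = (qDeriv q ^ h) (qDeriv q f) := by
  rw [pow_succ, Module.End.mul_apply]

/-- Iterates `DU = qUD + 1`. At `h = 0` the truncated exponent `h - 1` is harmless because `[0] =
0`. -/
theorem qDeriv_pow_X_mul (q : R) (h : ℕ) (f : R[X]) :
    (qDeriv q ^ h) (X * f) =
      C (q ^ h) * X * (qDeriv q ^ h) f + C (qNum q h) * (qDeriv q ^ (h - 1)) f := by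
  induction h with
  | zero => simp
  | succ h ih =>
    rw [qDeriv_pow_succ, ih, map_add, mul_assoc, qDeriv_C_mul, qDeriv_X_mul, qDeriv_C_mul,
      qDeriv_pow_succ, Nat.add_sub_cancel, qNum_succ]
    cases h with
    | zero => simp [add_comm]
    | succ h =>
      rw [Nat.add_sub_cancel, ← qDeriv_pow_succ, ← qDeriv_pow_succ]
      simp only [map_add, map_pow]
      ring

theorem qDeriv_pow_X_mul_qDeriv (q : R) (h : ℕ) (f : R[X]) :
    (qDeriv q ^ h) (X * qDeriv q f) =
      C (q ^ h) * X * (qDeriv q ^ (h + 1)) f + C (qNum q h) * (qDeriv q ^ h) f := by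
  rw [qDeriv_pow_X_mul]
  cases h with
  | zero => simp
  | succ h =>
    rw [Nat.add_sub_cancel, ← qDeriv_pow_succ', ← qDeriv_pow_succ']

/-- The operator `s D + U D U`. -/
noncomputable def scaledOp (q s : R) : Module.End R R[X] :=
  s • qDeriv q + mulT * qDeriv q * mulT

theorem scaledOp_apply (q s : R) (f : R[X]) :
    scaledOp q s f = C s * qDeriv q f + X * (f + C q * X * qDeriv q f) := by
  rw [← qDeriv_X_mul, ← smul_eq_C_mul]
  rfl

theorem qDeriv_pow_scaledOp (q s : R) (h : ℕ) (f : R[X]) :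
    (qDeriv q ^ h) (scaledOp q s f) =
      (C s + C (q ^ (2 * h + 1)) * X ^ 2) * (qDeriv q ^ (h + 1)) f +
      C (q ^ h) * X * (C (qNum q (h + 1)) + C (qNum q h)) * (qDeriv q ^ h) f +
      C (qNum q h) ^ 2 * (qDeriv q ^ (h - 1)) f := by
  -- Writing `UDU` as `U + qU²D` leaves only factors `X` for `D ^ h` to move past.
  have e : scaledOp q s f =
      C s * qDeriv q f + X * f + C q * (X * (X * qDeriv q f)) := by
    rw [scaledOp_apply]; ring
  rw [e, map_add, map_add, qDeriv_pow_C_mul, qDeriv_pow_C_mul, qDeriv_pow_X_mul q h f,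
    qDeriv_pow_X_mul q h (X * qDeriv q f), qDeriv_pow_X_mul_qDeriv, qDeriv_pow_X_mul_qDeriv,
    ← Module.End.mul_apply, ← pow_succ]
  cases h with
  | zero => simp [qNum]; ring
  | succ h =>
    simp only [Nat.add_sub_cancel]
    rw [qNum_succ' q (h + 1), qNum_succ' q h]
    simp only [map_add, map_mul, map_pow, map_one]
    ring

/-- `D ^ h` applied to `(s D + U D U) ^ m 1`. -/
noncomputable def pathPoly (q s : R) (m h : ℕ) : R[X] := (qDeriv q ^ h) ((scaledOp q s ^ m) 1)

theorem pathPoly_zero_left (q s : R) (h : ℕ) : pathPoly q s 0 h = if h = 0 then 1 else 0 := by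
  rw [pathPoly, pow_zero, Module.End.one_apply]
  cases h with
  | zero => simp
  | succ h =>
    rw [pow_succ, Module.End.mul_apply, ← C_1, ← monomial_zero_left, qDeriv_monomial]
    simp

/-- The coefficients are kept in the form in which the scan of a pair of points produces them:
open-open, then open-close plus close-open, then close-close. -/
theorem pathPoly_succ (q s : R) (hs : q * s = -1) (m h : ℕ) :
    pathPoly q s (m + 1) h =
      (C s + X * C (q ^ h)) * (1 + X * C (q ^ (h + 1))) * pathPoly q s m (h + 1) +
      (C s * C (qNum q (h + 1) - 1) + X * C (q ^ h) * C (qNum q (h + 1)) +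
        C (qNum q h) * (1 + X * C (q ^ h))) * pathPoly q s m h +
      C (qNum q h) ^ 2 * pathPoly q s m (h - 1) := by
  rw [pathPoly, pow_succ', Module.End.mul_apply, qDeriv_pow_scaledOp, ← pathPoly, ← pathPoly,
    ← pathPoly]
  have hC : C q * C s = (-1 : R[X]) := by rw [← C_mul, hs]; simp
  rw [qNum_succ']
  simp only [map_add, map_mul, map_pow, map_one, add_sub_cancel_left]
  -- The two uses of `qs = -1`: the cross term of open-open, and the loss `s([h+1] - 1)` against the
  -- close-open term `[h]`.
  linear_combination (-(X * C q ^ h * pathPoly q s m (h + 1)) - C (qNum q h) * pathPoly q s m h) * hC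

end QDerivative

/-! ### Signed arc diagrams and their loose ends -/

/-- A signed arc diagram on the natural numbers: `x` is joined to `tau x` (and is a loose end if
`tau x = x`), and `eps x` tells whether the arc at `x` is negative. -/
@[ext]
structure ArcDiagram where
  /-- The other end of the arc at a given point. -/
  tau : ℕ → ℕ
  /-- Whether the arc at a given point is negative. -/
  eps : ℕ → Bool

namespace ArcDiagram

/-- The part of an arc diagram to the left of `x`: arcs that cross `x` are cut open. -/
def restr (x : ℕ) (P : ArcDiagram) : ArcDiagram where
  tau y := if y < x ∧ P.tau y < x then P.tau y else y
  eps y := decide (y < x) && P.eps y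

/-- The arc diagrams supported on `{2, …, x - 1}` whose arcs join points of different parity. -/
structure IsPartial (x : ℕ) (P : ArcDiagram) : Prop where
  invol : ∀ y, P.tau (P.tau y) = y
  tau_ge : ∀ y, x ≤ y → P.tau y = y
  tau_lt : ∀ y, y < 2 → P.tau y = y
  odd : ∀ y, P.tau y ≠ y → P.tau y % 2 ≠ y % 2
  eps_tau : ∀ y, P.eps (P.tau y) = P.eps y
  eps_ge : ∀ y, x ≤ y → P.eps y = false
  eps_lt : ∀ y, y < 2 → P.eps y = false

/-- The partial arc diagrams without loose ends. -/
structure IsComplete (x : ℕ) (P : ArcDiagram) : Prop extends IsPartial x P where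
  tau_ne : ∀ y, 2 ≤ y → y < x → P.tau y ≠ y

/-- The points to the left of `x` that are not joined to a point to the left of `x`. -/
def loose (x : ℕ) (P : ArcDiagram) : Finset ℕ :=
  (Finset.Ico 2 x).filter fun y => P.tau y = y ∨ x ≤ P.tau y

theorem mem_loose {x : ℕ} {P : ArcDiagram} {y : ℕ} :
    y ∈ P.loose x ↔ (2 ≤ y ∧ y < x) ∧ (P.tau y = y ∨ x ≤ P.tau y) := by
  simp [loose]

/-- The loose ends to the left of `x` of parity `r`. -/
def looseMod (x r : ℕ) (P : ArcDiagram) : Finset ℕ :=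
  (P.loose x).filter fun y => y % 2 = r

theorem mem_looseMod {x r : ℕ} {P : ArcDiagram} {y : ℕ} :
    y ∈ P.looseMod x r ↔ ((2 ≤ y ∧ y < x) ∧ (P.tau y = y ∨ x ≤ P.tau y)) ∧ y % 2 = r := by
  simp [looseMod, mem_loose]

/-- The signed position of a point. -/
def height (P : ArcDiagram) (y : ℕ) : ℤ := if P.eps y then -y else y

/-- The loose ends of the parity of `tau x` that are higher than `tau x`. -/
def above (x : ℕ) (P : ArcDiagram) : Finset ℕ :=
  (P.looseMod x ((x + 1) % 2)).filter fun y => P.height (P.tau x) < P.height y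

/-- Join the loose end `y` to `x`. -/
def close (x y : ℕ) (P : ArcDiagram) : ArcDiagram where
  tau z := if z = x then y else if z = y then x else P.tau z
  eps z := if z = x then P.eps y else P.eps z

/-- Add `x` as a loose end of sign `b`. -/
def opened (x : ℕ) (b : Bool) (P : ArcDiagram) : ArcDiagram where
  tau := P.tau
  eps z := if z = x then b else P.eps z

/-! ### Cutting a diagram and extending it by one point -/

section Restr

variable {x n : ℕ} {P p : ArcDiagram}

theorem height_injective (P : ArcDiagram) : Function.Injective P.height := by
  intro y z h
  unfold height at h
  split_ifs at h <;> omega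

theorem IsPartial.tau_lt_of_lt (hp : p.IsPartial x) {y : ℕ} (hy : y < x) : p.tau y < x := by
  by_contra! h
  have := hp.tau_ge _ h
  rw [hp.invol] at this
  omega

theorem IsPartial.two_le_tau (hp : p.IsPartial x) {y : ℕ} (hy : 2 ≤ y) : 2 ≤ p.tau y := by
  by_contra! h
  have := hp.tau_lt _ h
  rw [hp.invol] at this
  omega

theorem restr_restr {x y : ℕ} (h : x ≤ y) (P : ArcDiagram) : (P.restr y).restr x = P.restr x := by
  ext z
  · simp only [restr]
    split_ifs <;> omega
  · simp only [restr]
    by_cases hz : z < x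
    · simp [hz, hz.trans_le h]
    · simp [hz]

theorem IsPartial.restr_eq (hp : p.IsPartial x) : p.restr x = p := by
  ext z
  · simp only [restr]
    by_cases hz : z < x
    · simp [hz, hp.tau_lt_of_lt hz]
    · simp [hz, hp.tau_ge z (by omega)]
  · simp only [restr]
    by_cases hz : z < x
    · simp [hz]
    · simp [hz, hp.eps_ge z (by omega)]

theorem IsPartial.restr_opened (hp : p.IsPartial x) (b : Bool) :
    (p.opened x b).restr x = p := by
  conv_rhs => rw [← hp.restr_eq]
  ext z
  · rfl
  · simp only [restr, opened]
    by_cases hz : z < x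
    · simp [hz, hz.ne]
    · simp [hz]

theorem IsPartial.restr_close (hp : p.IsPartial x) {y : ℕ} (hy : y ∈ p.loose x) :
    (p.close x y).restr x = p := by
  rw [mem_loose] at hy
  have hy' : p.tau y = y := by
    have := hp.tau_lt_of_lt hy.1.2
    omega
  conv_rhs => rw [← hp.restr_eq]
  ext z
  · simp only [restr, close]
    by_cases hz : z < x
    · by_cases hzy : z = y
      · subst hzy
        simp [hz, hz.ne, hy']
      · simp [hz, hz.ne, hzy]
    · simp [hz]
  · simp only [restr, close]
    by_cases hz : z < x
    · simp [hz, hz.ne]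
    · simp [hz]

theorem IsPartial.opened (hp : p.IsPartial x) (hx : 2 ≤ x) (b : Bool) :
    (p.opened x b).IsPartial (x + 1) where
  invol := hp.invol
  tau_ge y hy := hp.tau_ge y (by omega)
  tau_lt := hp.tau_lt
  odd := hp.odd
  eps_tau y := by
    simp only [ArcDiagram.opened]
    by_cases h : y = x
    · simp [h, hp.tau_ge x le_rfl]
    · have : p.tau y ≠ x := fun h' => h (by rw [← hp.invol y, h', hp.tau_ge x le_rfl])
      simp [h, this, hp.eps_tau]
  eps_ge y hy := by
    simp only [ArcDiagram.opened]
    rw [if_neg (by omega), hp.eps_ge y (by omega)]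
  eps_lt y hy := by
    simp only [ArcDiagram.opened]
    rw [if_neg (by omega), hp.eps_lt y hy]

theorem IsPartial.tau_eq_of_mem_loose (hp : p.IsPartial x) {y : ℕ} (hy : y ∈ p.loose x) :
    p.tau y = y := by
  rw [mem_loose] at hy
  have := hp.tau_lt_of_lt hy.1.2
  omega

theorem IsPartial.close (hp : p.IsPartial x) (hx : 2 ≤ x) {y : ℕ}
    (hy : y ∈ p.looseMod x ((x + 1) % 2)) : (p.close x y).IsPartial (x + 1) := by
  obtain ⟨hy, hpar⟩ := Finset.mem_filter.1 hy
  have hy' := hp.tau_eq_of_mem_loose hy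
  rw [mem_loose] at hy
  have hxx := hp.tau_ge x le_rfl
  have hne : ∀ z, z ≠ x → p.tau z ≠ x := fun z h h' => h (by rw [← hp.invol z, h', hxx])
  have hne' : ∀ z, z ≠ y → p.tau z ≠ y := fun z h h' => h (by rw [← hp.invol z, h', hy'])
  refine ⟨fun z => ?_, fun z hz => ?_, fun z hz => ?_, fun z => ?_, fun z => ?_, fun z hz => ?_,
    fun z hz => ?_⟩
  · simp only [ArcDiagram.close]
    by_cases h1 : z = x
    · simp [h1, show y ≠ x by omega]
    · by_cases h2 : z = y
      · simp [h2, show y ≠ x by omega]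
      · simp [h1, h2, hne z h1, hne' z h2, hp.invol]
  · simp only [ArcDiagram.close]
    rw [if_neg (by omega), if_neg (by omega), hp.tau_ge z (by omega)]
  · simp only [ArcDiagram.close]
    rw [if_neg (by omega), if_neg (by omega), hp.tau_lt z (by omega)]
  · simp only [ArcDiagram.close]
    split_ifs with h1 h2
    · omega
    · omega
    · exact hp.odd z
  · simp only [ArcDiagram.close]
    by_cases h1 : z = x
    · simp [h1, show y ≠ x by omega]
    · by_cases h2 : z = y
      · simp [h2, show y ≠ x by omega]
      · simp [h1, h2, hne z h1, hp.eps_tau]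
  · simp only [ArcDiagram.close]
    rw [if_neg (by omega), hp.eps_ge z (by omega)]
  · simp only [ArcDiagram.close]
    rw [if_neg (by omega), hp.eps_lt z (by omega)]

theorem loose_restr {y : ℕ} (h : x ≤ y) (P : ArcDiagram) :
    (P.restr y).loose x = P.loose x := by
  ext z
  simp only [mem_loose, restr]
  split_ifs <;> omega

/-- Together with `restr_succ_of_lt` this lists all ways to pass from the cut at `x` to the cut at
`x + 1`. -/
theorem IsPartial.restr_succ_of_le (hP : P.IsPartial n) (hx : x ≤ P.tau x) :
    P.restr (x + 1) = (P.restr x).opened x (P.eps x) := by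
  ext z
  · simp only [restr, ArcDiagram.opened]
    have h := hP.invol z
    by_cases hz : P.tau z = x
    · rw [hz] at h
      rw [hz]
      split_ifs <;> omega
    · split_ifs <;> first | rfl | omega | skip
      have : z = x := by omega
      subst this
      omega
  · simp only [restr, ArcDiagram.opened]
    by_cases h : z = x
    · simp [h]
    · simp [h, show z < x + 1 ↔ z < x by omega]

theorem IsPartial.restr_succ_of_lt (hP : P.IsPartial n) (hx : P.tau x < x) :
    P.restr (x + 1) = (P.restr x).close x (P.tau x) := by
  ext z
  · simp only [restr, ArcDiagram.close]
    have h := hP.invol z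
    by_cases hz : z = x
    · subst hz
      rw [if_pos (by omega), if_pos rfl]
    · rw [if_neg hz]
      by_cases hz' : z = P.tau x
      · rw [if_pos hz', hz', hP.invol, if_pos (by omega)]
      · rw [if_neg hz']
        have : P.tau z ≠ x := fun e => hz' (by rw [← e, h])
        split_ifs <;> omega
  · simp only [restr, ArcDiagram.close]
    by_cases h : z = x
    · simp [h, hx, hP.eps_tau]
    · simp [h, show z < x + 1 ↔ z < x by omega]

theorem IsPartial.tau_mem_looseMod (hP : P.IsPartial n) (h2 : 2 ≤ x) (hx : P.tau x < x) :
    P.tau x ∈ (P.restr x).looseMod x ((x + 1) % 2) := by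
  rw [looseMod, loose_restr le_rfl, Finset.mem_filter, mem_loose, hP.invol]
  have := hP.odd x hx.ne
  have := hP.two_le_tau h2
  omega

end Restr

/-! ### Local weights and one step of the scan -/

section Weight

variable {R : Type*} [CommRing R]

/-- The contribution of the point `x` to the weight of an arc diagram. An arc from an even point
`y` to `y + 1` that is not negative kills the weight. -/
noncomputable def weight (q s : R) (x : ℕ) (P : ArcDiagram) : R[X] :=
  if x ≤ P.tau x then
    if P.eps x then X * C (q ^ (P.looseMod x ((x + 1) % 2)).card)
    else if x % 2 = 0 then C s else 1
  else if x % 2 = 1 ∧ P.tau x + 1 = x ∧ P.eps x = false then 0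
  else C (q ^ (P.above x).card)

/-- Locality of the weight: the contribution of `x` is constant on the diagrams with a given part to
the left of `x + 1`, so it factors out of the fiber sums. -/
theorem weight_restr (q s : R) (x : ℕ) (P : ArcDiagram) :
    weight q s x (P.restr (x + 1)) = weight q s x P := by
  have h1 : (P.restr (x + 1)).eps x = P.eps x := by simp [restr]
  have h2 : (P.restr (x + 1)).looseMod x ((x + 1) % 2) = P.looseMod x ((x + 1) % 2) := by
    rw [looseMod, looseMod, loose_restr (by omega)]
  unfold weight above
  rw [h1, h2]
  by_cases hx : x ≤ P.tau x
  · have : x ≤ (P.restr (x + 1)).tau x := by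
      simp only [restr]; split_ifs <;> omega
    simp only [hx, this, if_true]
  · have : (P.restr (x + 1)).tau x = P.tau x := by
      simp only [restr]; split_ifs <;> omega
    rw [this, if_neg hx, if_neg hx]
    congr 4
    refine Finset.filter_congr fun y hy => ?_
    have hy := (mem_looseMod.1 hy).1.1
    simp only [height, restr, show y < x + 1 by omega, show P.tau x < x + 1 by omega, decide_true,
      Bool.true_and]

open scoped Classical in
/-- The total weight of the members of `Ω` with a given part to the left of `x`, counting only
the contributions of the points from `x` on. -/
noncomputable def fiberSum (q s : R) (N : ℕ) (Ω : Finset ArcDiagram) (x : ℕ) (p : ArcDiagram) :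
    R[X] :=
  ∑ P ∈ Ω.filter fun P => P.restr x = p, ∏ y ∈ Finset.Ico x N, weight q s y P

theorem fiberSum_step (q s : R) {N x : ℕ} {Ω : Finset ArcDiagram}
    (hΩ : ∀ P, P ∈ Ω ↔ P.IsComplete N) (h2 : 2 ≤ x) (hx : x < N) {p : ArcDiagram}
    (hp : p.IsPartial x) :
    fiberSum q s N Ω x p =
      weight q s x (p.opened x false) * fiberSum q s N Ω (x + 1) (p.opened x false) +
      weight q s x (p.opened x true) * fiberSum q s N Ω (x + 1) (p.opened x true) +
      ∑ y ∈ p.looseMod x ((x + 1) % 2),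
        weight q s x (p.close x y) * fiberSum q s N Ω (x + 1) (p.close x y) := by
  classical
  have key : ∀ c : ArcDiagram, c.restr x = p →
      ∑ P ∈ (Ω.filter fun P => P.restr x = p).filter (fun P => P.restr (x + 1) = c),
        ∏ y ∈ Finset.Ico x N, weight q s y P =
      weight q s x c * fiberSum q s N Ω (x + 1) c := by
    intro c hc
    rw [fiberSum, Finset.mul_sum, Finset.filter_filter]
    refine Finset.sum_congr (Finset.filter_congr fun P _ => ?_) fun P hP => ?_
    · constructor
      · exact fun h => h.2
      · intro h
        refine ⟨?_, h⟩
        rw [← restr_restr (Nat.le_succ x), h, hc]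
    · rw [Finset.prod_eq_prod_Ico_succ_bot hx, ← weight_restr, (Finset.mem_filter.1 hP).2]
  have hclose : ∀ y ∈ p.looseMod x ((x + 1) % 2), (p.close x y).restr x = p := fun y hy =>
    hp.restr_close (Finset.mem_filter.1 hy).1
  -- The fiber at `x` is partitioned by the part to the left of `x + 1`; the point `x` either opens
  -- with one of two signs or closes a loose end.
  have hmaps : ∀ P ∈ Ω.filter (fun P => P.restr x = p), P.restr (x + 1) ∈
      ({p.opened x false, p.opened x true} : Finset ArcDiagram) ∪
        (p.looseMod x ((x + 1) % 2)).image fun y => p.close x y := by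
    intro P hP
    obtain ⟨hPΩ, rfl⟩ := Finset.mem_filter.1 hP
    have hP := ((hΩ P).1 hPΩ).toIsPartial
    rw [Finset.mem_union]
    rcases le_or_gt x (P.tau x) with h | h
    · left
      rw [hP.restr_succ_of_le h]
      cases P.eps x <;> simp
    · right
      rw [hP.restr_succ_of_lt h]
      exact Finset.mem_image_of_mem _ (hP.tau_mem_looseMod h2 h)
  rw [fiberSum, ← Finset.sum_fiberwise_of_maps_to hmaps, Finset.sum_union, Finset.sum_pair,
    Finset.sum_image, key _ (hp.restr_opened _), key _ (hp.restr_opened _)]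
  · congr 1
    exact Finset.sum_congr rfl fun y hy => key _ (hclose y hy)
  · intro y _ z _ h
    simpa [close] using congrFun (congrArg ArcDiagram.tau h) x
  · intro h
    simpa [opened] using congrFun (congrArg ArcDiagram.eps h) x
  · have : ∀ b, p.opened x b ∉ (p.looseMod x ((x + 1) % 2)).image fun y => p.close x y := by
      intro b h
      obtain ⟨y, hy, h⟩ := Finset.mem_image.1 h
      have h := congrFun (congrArg ArcDiagram.tau h) x
      simp only [close, opened, if_true] at h
      rw [hp.tau_ge x le_rfl] at h
      have := (mem_looseMod.1 hy).1.1
      omega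
    rw [Finset.disjoint_left]
    intro c hc
    rw [Finset.mem_insert, Finset.mem_singleton] at hc
    rcases hc with rfl | rfl <;> exact this _

end Weight

end ArcDiagram

/-- The exponents are the ranks of the elements, hence `0, …, |S| - 1`. Inserting a new minimum
leaves the earlier ranks unchanged and adds the next power. -/
theorem sum_pow_card_filter_lt {R ι : Type*} [CommRing R] (q : R) (S : Finset ι) (f : ι → ℤ)
    (hf : Function.Injective f) :
    ∑ y ∈ S, q ^ (S.filter fun z => f y < f z).card = qNum q S.card := by
  classical
  induction S using Finset.induction_on_min_value f with
  | empty => simp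
  | insert a S ha hmin ih =>
    rw [Finset.sum_insert ha, Finset.card_insert_of_notMem ha, qNum_succ, ← ih, add_comm]
    congr 1
    · refine Finset.sum_congr rfl fun y hy => ?_
      rw [Finset.filter_insert, if_neg (not_lt.2 (hmin y hy))]
    · rw [Finset.filter_insert, if_neg (lt_irrefl _), Finset.filter_true_of_mem]
      intro z hz
      exact lt_of_le_of_ne (hmin z hz) fun h => ha (hf h ▸ hz)

/-! ### Loose-end counts and evaluation of the scan -/

namespace ArcDiagram

section Loose

variable {x r : ℕ} {p : ArcDiagram} {b : Bool}

theorem IsPartial.looseMod_opened_self (hp : p.IsPartial x) (hx : 2 ≤ x) :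
    (p.opened x b).looseMod (x + 1) (x % 2) = insert x (p.looseMod x (x % 2)) := by
  ext z
  rw [Finset.mem_insert, mem_looseMod, mem_looseMod]
  have h1 := hp.tau_ge x le_rfl
  have h2 : z < x → p.tau z < x := hp.tau_lt_of_lt
  simp only [ArcDiagram.opened]
  by_cases h : z = x
  · subst h; omega
  · omega

theorem IsPartial.looseMod_opened (hp : p.IsPartial x) (hr : x % 2 ≠ r) :
    (p.opened x b).looseMod (x + 1) r = p.looseMod x r := by
  ext z
  rw [mem_looseMod, mem_looseMod]
  have h2 : z < x → p.tau z < x := hp.tau_lt_of_lt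
  simp only [ArcDiagram.opened]
  by_cases h : z = x
  · subst h; omega
  · omega

theorem IsPartial.looseMod_close (hp : p.IsPartial x) {y : ℕ} (hy : y ∈ p.loose x) :
    (p.close x y).looseMod (x + 1) r = (p.looseMod x r).erase y := by
  ext z
  rw [mem_loose] at hy
  rw [Finset.mem_erase, mem_looseMod, mem_looseMod]
  have h2 : z < x → p.tau z < x := hp.tau_lt_of_lt
  simp only [ArcDiagram.close]
  split_ifs <;> omega

theorem IsPartial.card_looseMod_opened_self (hp : p.IsPartial x) (hx : 2 ≤ x) (hr : x % 2 = r) :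
    ((p.opened x b).looseMod (x + 1) r).card = (p.looseMod x r).card + 1 := by
  subst hr
  rw [hp.looseMod_opened_self hx, Finset.card_insert_of_notMem]
  rw [mem_looseMod]
  omega

theorem IsPartial.card_looseMod_close_self (hp : p.IsPartial x) {y : ℕ}
    (hy : y ∈ p.looseMod x r) :
    ((p.close x y).looseMod (x + 1) r).card = (p.looseMod x r).card - 1 := by
  rw [hp.looseMod_close (Finset.mem_filter.1 hy).1, Finset.card_erase_of_mem hy]

theorem IsPartial.card_looseMod_close (hp : p.IsPartial x) {y r' : ℕ}
    (hy : y ∈ p.looseMod x r') (hr : r' ≠ r) :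
    ((p.close x y).looseMod (x + 1) r).card = (p.looseMod x r).card := by
  rw [hp.looseMod_close (Finset.mem_filter.1 hy).1, Finset.erase_eq_of_notMem]
  rw [mem_looseMod] at hy ⊢
  omega

end Loose

section Weight

variable {R : Type*} [CommRing R] {x : ℕ} {p : ArcDiagram}

theorem IsPartial.weight_opened_false (hp : p.IsPartial x) (q s : R) :
    weight q s x (p.opened x false) = if x % 2 = 0 then C s else 1 := by
  simp [weight, ArcDiagram.opened, hp.tau_ge x le_rfl]

theorem IsPartial.weight_opened_true (hp : p.IsPartial x) (q s : R) :
    weight q s x (p.opened x true) = X * C (q ^ (p.looseMod x ((x + 1) % 2)).card) := by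
  simp [weight, ArcDiagram.opened, hp.tau_ge x le_rfl, looseMod, loose]

theorem IsPartial.weight_close (hp : p.IsPartial x) (q s : R) {y : ℕ}
    (hy : y ∈ p.looseMod x ((x + 1) % 2)) :
    weight q s x (p.close x y) = if x % 2 = 1 ∧ y + 1 = x ∧ p.eps y = false then 0 else
      C (q ^ ((p.looseMod x ((x + 1) % 2)).filter fun z => p.height y < p.height z).card) := by
  have hyx := (mem_looseMod.1 hy).1.1.2
  have ht : (p.close x y).tau x = y := by simp [ArcDiagram.close]
  have he : (p.close x y).eps x = p.eps y := by simp [ArcDiagram.close]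
  have hl : (p.close x y).looseMod x ((x + 1) % 2) = p.looseMod x ((x + 1) % 2) := by
    conv_rhs => rw [← hp.restr_close (Finset.mem_filter.1 hy).1]
    rw [looseMod, looseMod, loose_restr le_rfl]
  rw [weight, ht, he, if_neg (by omega), above, hl, ht]
  congr 4
  refine Finset.filter_congr fun z hz => ?_
  have hzx := (mem_looseMod.1 hz).1.1.2
  simp [height, ArcDiagram.close, hyx.ne, hzx.ne]

theorem IsPartial.sum_weight_close (hp : p.IsPartial x) (q s : R)
    (h : x % 2 = 1 → ∀ y ∈ p.looseMod x ((x + 1) % 2), y + 1 = x → p.eps y = true) :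
    ∑ y ∈ p.looseMod x ((x + 1) % 2), weight q s x (p.close x y) =
      C (qNum q (p.looseMod x ((x + 1) % 2)).card) := by
  rw [← sum_pow_card_filter_lt q _ p.height p.height_injective, map_sum]
  refine Finset.sum_congr rfl fun y hy => ?_
  rw [hp.weight_close q s hy, if_neg]
  rintro ⟨h1, h2, h3⟩
  rw [h h1 y hy h2] at h3
  simp at h3

/-- A positive end opened at `x` has the greatest height, so joining it would have weight `q^0 = 1`.
That join is a fixed point and is killed, whence the `-1`. -/
theorem IsPartial.sum_weight_close_of_eps (hp : p.IsPartial (x + 1)) (q s : R)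
    (hx : x % 2 = 0) (h : x ∈ p.looseMod (x + 1) ((x + 1 + 1) % 2)) (he : p.eps x = false) :
    ∑ y ∈ p.looseMod (x + 1) ((x + 1 + 1) % 2), weight q s (x + 1) (p.close (x + 1) y) =
      C (qNum q (p.looseMod (x + 1) ((x + 1 + 1) % 2)).card - 1) := by
  rw [← sum_pow_card_filter_lt q _ p.height p.height_injective, ← Finset.add_sum_erase _ _ h,
    ← Finset.add_sum_erase _ _ h, hp.weight_close q s h, if_pos ⟨by omega, rfl, he⟩, zero_add]
  have : ((p.looseMod (x + 1) ((x + 1 + 1) % 2)).filter fun z => p.height x < p.height z) = ∅ := by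
    refine Finset.filter_false_of_mem fun z hz => ?_
    have := (mem_looseMod.1 hz).1.1.2
    simp only [height, he, Bool.false_eq_true, if_false]
    split_ifs <;> omega
  rw [this, Finset.card_empty, pow_zero, add_sub_cancel_left, map_sum]
  refine Finset.sum_congr rfl fun y hy => ?_
  obtain ⟨hne, hy⟩ := Finset.mem_erase.1 hy
  rw [hp.weight_close q s hy, if_neg (by omega)]

/-- Only `p` itself can lie in its fiber, and it does so exactly when nothing is loose;
correspondingly `D ^ h 1` vanishes for `h > 0`. -/
theorem fiberSum_end (q s : R) {N : ℕ} {Ω : Finset ArcDiagram}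
    (hΩ : ∀ P, P ∈ Ω ↔ P.IsComplete N) {p : ArcDiagram} (hp : p.IsPartial N)
    (h : (p.looseMod N 0).card = (p.looseMod N 1).card) :
    fiberSum q s N Ω N p = pathPoly q s 0 (p.looseMod N 0).card := by
  classical
  rw [pathPoly_zero_left, fiberSum]
  have hcomp : (p.looseMod N 0).card = 0 ↔ p.IsComplete N := by
    constructor
    · intro h0
      rw [h0, eq_comm, Finset.card_eq_zero] at h
      rw [Finset.card_eq_zero] at h0
      refine ⟨hp, fun y h2 hy hyy => ?_⟩
      rcases Nat.mod_two_eq_zero_or_one y with hr | hr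
      · exact Finset.notMem_empty y (h0 ▸ mem_looseMod.2 ⟨⟨⟨h2, hy⟩, Or.inl hyy⟩, hr⟩)
      · exact Finset.notMem_empty y (h ▸ mem_looseMod.2 ⟨⟨⟨h2, hy⟩, Or.inl hyy⟩, hr⟩)
    · intro hc
      rw [Finset.card_eq_zero, Finset.eq_empty_iff_forall_notMem]
      intro y hy
      have h1 := hp.tau_eq_of_mem_loose (Finset.mem_filter.1 hy).1
      rw [mem_looseMod] at hy
      exact hc.tau_ne y hy.1.1.1 hy.1.1.2 h1
  have hf : (Ω.filter fun P => P.restr N = p) = if p.IsComplete N then {p} else ∅ := by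
    ext P
    rw [Finset.mem_filter, hΩ]
    constructor
    · rintro ⟨h1, h2⟩
      rw [h1.toIsPartial.restr_eq] at h2
      subst h2
      simp [h1]
    · split_ifs with h1
      · rw [Finset.mem_singleton]
        rintro rfl
        exact ⟨h1, hp.restr_eq⟩
      · simp
  rw [hf]
  by_cases hc : p.IsComplete N
  · rw [if_pos hc, if_pos (hcomp.2 hc)]
    simp
  · rw [if_neg hc, if_neg (hcomp.not.2 hc)]
    simp

/-- The half step from an odd cut, where one more even end than odd is loose. The closing weights
stay unevaluated because their sum depends on whether the preceding point is a positive loose end.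
-/
theorem fiberSum_odd (q s : R) {N x a m : ℕ} {Ω : Finset ArcDiagram}
    (hΩ : ∀ P, P ∈ Ω ↔ P.IsComplete N) (h2 : 2 ≤ x) (hxN : x < N) (hx : x % 2 = 1)
    {p : ArcDiagram} (hp : p.IsPartial x) (ha : (p.looseMod x 0).card = a)
    (hb : (p.looseMod x 1).card + 1 = a)
    (ih : ∀ p : ArcDiagram, p.IsPartial (x + 1) →
      (p.looseMod (x + 1) 0).card = (p.looseMod (x + 1) 1).card →
      fiberSum q s N Ω (x + 1) p = pathPoly q s m (p.looseMod (x + 1) 0).card) :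
    fiberSum q s N Ω x p = (1 + X * C (q ^ a)) * pathPoly q s m a +
      (∑ y ∈ p.looseMod x ((x + 1) % 2), weight q s x (p.close x y)) *
        pathPoly q s m (a - 1) := by
  have hr : (x + 1) % 2 = 0 := by omega
  have ho : ∀ b, fiberSum q s N Ω (x + 1) (p.opened x b) = pathPoly q s m a := fun b => by
    have e0 : ((p.opened x b).looseMod (x + 1) 0).card = a := by
      rw [hp.looseMod_opened (by omega), ha]
    have e1 : ((p.opened x b).looseMod (x + 1) 1).card = a := by
      rw [hp.card_looseMod_opened_self h2 hx, hb]
    rw [ih _ (hp.opened h2 b) (e0.trans e1.symm), e0]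
  have hc : ∀ y ∈ p.looseMod x ((x + 1) % 2), fiberSum q s N Ω (x + 1) (p.close x y) =
      pathPoly q s m (a - 1) := fun y hy => by
    have hy' := hy
    rw [hr] at hy'
    have e0 : ((p.close x y).looseMod (x + 1) 0).card = a - 1 := by
      rw [hp.card_looseMod_close_self hy', ha]
    have e1 : ((p.close x y).looseMod (x + 1) 1).card = a - 1 := by
      rw [hp.card_looseMod_close hy' (by omega)]; omega
    rw [ih _ (hp.close h2 hy) (e0.trans e1.symm), e0]
  rw [fiberSum_step q s hΩ h2 hxN hp, ho, ho, hp.weight_opened_false, hp.weight_opened_true, hr, ha,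
    if_neg (by omega), Finset.sum_mul, ← hr, Finset.sum_congr rfl fun y hy => by rw [hc y hy]]
  ring

/-- The induction advances by pairs of points, since the loose ends of both parities balance only at
even cuts. -/
theorem fiberSum_even (q s : R) (hs : q * s = -1) {N : ℕ} {Ω : Finset ArcDiagram}
    (hΩ : ∀ P, P ∈ Ω ↔ P.IsComplete N) (m : ℕ) :
    ∀ (x : ℕ) (p : ArcDiagram), x + 2 * m = N → x % 2 = 0 → 2 ≤ x → p.IsPartial x →
      (p.looseMod x 0).card = (p.looseMod x 1).card →
      fiberSum q s N Ω x p = pathPoly q s m (p.looseMod x 0).card := by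
  induction m with
  | zero =>
    rintro x p rfl - - hp h
    exact fiberSum_end q s hΩ hp h
  | succ m ih =>
    intro x p hN hx h2 hp hab
    have hr : (x + 1) % 2 = 1 := by omega
    have hr' : (x + 1 + 1) % 2 = 0 := by omega
    obtain ⟨a, ha⟩ : ∃ a, (p.looseMod x 0).card = a := ⟨_, rfl⟩
    have hb := hab.symm.trans ha
    have ih' : ∀ p : ArcDiagram, p.IsPartial (x + 1 + 1) →
      (p.looseMod (x + 1 + 1) 0).card = (p.looseMod (x + 1 + 1) 1).card →
      fiberSum q s N Ω (x + 1 + 1) p = pathPoly q s m (p.looseMod (x + 1 + 1) 0).card :=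
      fun p => ih (x + 2) p (by omega) (by omega) (by omega)
    have o0 : ∀ b, ((p.opened x b).looseMod (x + 1) 0).card = a + 1 := fun b => by
      rw [hp.card_looseMod_opened_self h2 hx, ha]
    have o1 : ∀ b, ((p.opened x b).looseMod (x + 1) 1).card = a := fun b => by
      rw [hp.looseMod_opened (by omega), hb]
    have hmem : ∀ b, x ∈ (p.opened x b).looseMod (x + 1) ((x + 1 + 1) % 2) := fun b => by
      rw [hr', ← hx, hp.looseMod_opened_self h2]
      exact Finset.mem_insert_self _ _
    have hf : fiberSum q s N Ω (x + 1) (p.opened x false) =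
        (1 + X * C (q ^ (a + 1))) * pathPoly q s m (a + 1) +
          C (qNum q (a + 1) - 1) * pathPoly q s m a := by
      rw [fiberSum_odd q s hΩ (by omega) (by omega) hr (hp.opened h2 false) (o0 _)
        (by rw [o1]) ih', (hp.opened h2 false).sum_weight_close_of_eps q s hx (hmem _)
          (by simp [opened]), hr', o0, Nat.add_sub_cancel]
    have ht : fiberSum q s N Ω (x + 1) (p.opened x true) =
        (1 + X * C (q ^ (a + 1))) * pathPoly q s m (a + 1) +
          C (qNum q (a + 1)) * pathPoly q s m a := by
      rw [fiberSum_odd q s hΩ (by omega) (by omega) hr (hp.opened h2 true) (o0 _)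
        (by rw [o1]) ih', (hp.opened h2 true).sum_weight_close q s
          (fun _ y _ hy => by simp [opened, show y = x by omega]), hr', o0, Nat.add_sub_cancel]
    have hc : ∀ y ∈ p.looseMod x ((x + 1) % 2), fiberSum q s N Ω (x + 1) (p.close x y) =
        (1 + X * C (q ^ a)) * pathPoly q s m a + C (qNum q a) * pathPoly q s m (a - 1) := by
      intro y hy
      have hy' := hy
      rw [hr] at hy'
      have hpos : 0 < a := hb ▸ Finset.card_pos.2 ⟨y, hy'⟩
      have c0 : ((p.close x y).looseMod (x + 1) 0).card = a := by
        rw [hp.card_looseMod_close hy' (by omega), ha]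
      have c1 : ((p.close x y).looseMod (x + 1) 1).card + 1 = a := by
        rw [hp.card_looseMod_close_self hy']; omega
      rw [fiberSum_odd q s hΩ (by omega) (by omega) hr (hp.close h2 hy) c0 c1 ih',
        (hp.close h2 hy).sum_weight_close q s, hr', c0]
      -- Here `x` has closed an arc and is not loose, so joining it to `x + 1` is impossible and no
      -- fixed point is excluded.
      intro _ z hz hzx
      obtain rfl : z = x := by omega
      rw [hp.looseMod_close (Finset.mem_filter.1 hy).1] at hz
      have := (mem_looseMod.1 (Finset.mem_erase.1 hz).2).1.1.2
      omega
    rw [fiberSum_step q s hΩ h2 (by omega) hp, hp.weight_opened_false, hp.weight_opened_true,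
      hf, ht, Finset.sum_congr rfl fun y hy => by rw [hc y hy], ← Finset.sum_mul,
      hp.sum_weight_close q s (by omega), hr, hb, ha, if_pos hx, pathPoly_succ q s hs]
    ring

theorem sum_prod_weight (q s : R) (hs : q * s = -1) (n : ℕ) {Ω : Finset ArcDiagram}
    (hΩ : ∀ P, P ∈ Ω ↔ P.IsComplete (2 * n + 2)) :
    ∑ P ∈ Ω, ∏ y ∈ Finset.Ico 2 (2 * n + 2), weight q s y P = (scaledOp q s ^ n) 1 := by
  classical
  let p : ArcDiagram := ⟨id, fun _ => false⟩
  have hp : p.IsPartial 2 := by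
    constructor <;> simp [p]
  have h0 : ∀ r, p.looseMod 2 r = ∅ := fun r => by simp [looseMod, loose]
  have h := fiberSum_even q s hs hΩ n 2 p (by omega) rfl le_rfl hp (by rw [h0, h0])
  -- Every complete diagram is empty to the left of `2`, so the fiber over `p` is all of `Ω`.
  rw [h0, fiberSum, Finset.filter_true_of_mem] at h
  · exact h
  · intro P hP
    have hP := ((hΩ P).1 hP).toIsPartial
    ext y
    · have := hP.tau_lt y
      simp only [restr, p, id]
      split_ifs <;> omega
    · have := hP.eps_lt y
      simp only [restr, p, Bool.and_eq_false_imp, decide_eq_true_eq]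
      exact this

end Weight

end ArcDiagram

/-! ### Signed permutations as complete arc diagrams -/

namespace SignedPerm

variable {n : ℕ}

theorem mem_iff (z : ℤ) :
    z ∈ (Finset.Icc (-(n : ℤ)) (n : ℤ)).erase 0 ↔ 1 ≤ z.natAbs ∧ z.natAbs ≤ n := by
  rw [Finset.mem_erase, Finset.mem_Icc]; omega

/-- The extension of a signed permutation to all integers by the identity. -/
noncomputable def toFun (σ : SignedPerm n) (z : ℤ) : ℤ :=
  if h : z ∈ (Finset.Icc (-(n : ℤ)) (n : ℤ)).erase 0 then (σ.1 ⟨z, h⟩).1 else z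

theorem toFun_coe (σ : SignedPerm n) (i : PM n) : σ.toFun i.1 = σ.val i := by
  simp only [toFun, i.2, dif_pos, val]

theorem toFun_of_not (σ : SignedPerm n) {z : ℤ} (h : ¬(1 ≤ z.natAbs ∧ z.natAbs ≤ n)) :
    σ.toFun z = z := by
  rw [toFun, dif_neg (by rwa [mem_iff])]

theorem natAbs_toFun (σ : SignedPerm n) {z : ℤ} (h : 1 ≤ z.natAbs ∧ z.natAbs ≤ n) :
    1 ≤ (σ.toFun z).natAbs ∧ (σ.toFun z).natAbs ≤ n := by
  rw [toFun, dif_pos (by rwa [mem_iff]), ← mem_iff]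
  exact (σ.1 _).2

theorem toFun_neg (σ : SignedPerm n) (z : ℤ) : σ.toFun (-z) = -σ.toFun z := by
  by_cases h : 1 ≤ z.natAbs ∧ z.natAbs ≤ n
  · have h1 := (mem_iff z).2 h
    have h2 := (mem_iff (-z)).2 (by rwa [Int.natAbs_neg])
    rw [toFun, toFun, dif_pos h1, dif_pos h2]
    exact congrArg Subtype.val (σ.2 ⟨z, h1⟩)
  · rw [toFun_of_not σ h, toFun_of_not σ (by rwa [Int.natAbs_neg])]

/-- The inverse of a signed permutation. -/
def symm (σ : SignedPerm n) : SignedPerm n :=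
  ⟨σ.1.symm, fun i => by rw [Equiv.symm_apply_eq, σ.2, Equiv.apply_symm_apply]⟩

theorem symm_symm (σ : SignedPerm n) : σ.symm.symm = σ := rfl

theorem symm_toFun (σ : SignedPerm n) (z : ℤ) : σ.symm.toFun (σ.toFun z) = z := by
  by_cases h : 1 ≤ z.natAbs ∧ z.natAbs ≤ n
  · have h1 := (mem_iff z).2 h
    have h2 := natAbs_toFun σ h
    rw [← mem_iff] at h2
    rw [toFun, dif_pos h2]
    simp only [toFun, dif_pos h1, symm, Subtype.coe_eta, Equiv.symm_apply_apply]
  · rw [toFun_of_not σ h, toFun_of_not _ h]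

theorem toFun_natAbs (σ : SignedPerm n) (z : ℤ) :
    σ.toFun z.natAbs = if z < 0 then -σ.toFun z else σ.toFun z := by
  split_ifs with h
  · rw [← toFun_neg]; congr 1; omega
  · congr 1; omega

theorem natAbs_toFun_natAbs (σ : SignedPerm n) (z : ℤ) :
    (σ.toFun z.natAbs).natAbs = (σ.toFun z).natAbs := by
  rw [toFun_natAbs]; split_ifs <;> omega

theorem toFun_ne_zero (σ : SignedPerm n) {z : ℤ} (hz : z ≠ 0) : σ.toFun z ≠ 0 := by
  by_cases h : 1 ≤ z.natAbs ∧ z.natAbs ≤ n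
  · have := natAbs_toFun σ h; omega
  · rwa [toFun_of_not σ h]

theorem toFun_injective : Function.Injective (toFun : SignedPerm n → ℤ → ℤ) := by
  intro σ τ h
  refine Subtype.ext (Equiv.ext fun i => Subtype.ext ?_)
  have := congrFun h i.1
  rwa [toFun_coe, toFun_coe] at this

/-- The arc diagram of a signed permutation: the position `i` is the point `2 i`, the value
`±i` is the point `2 i + 1`. -/
noncomputable def toArc (σ : SignedPerm n) : ArcDiagram where
  tau x := if 1 ≤ x / 2 ∧ x / 2 ≤ n then
    if x % 2 = 0 then 2 * (σ.toFun (x / 2 : ℕ)).natAbs + 1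
    else 2 * (σ.symm.toFun (x / 2 : ℕ)).natAbs else x
  eps x := if x % 2 = 0 then decide (σ.toFun (x / 2 : ℕ) < 0)
    else decide (σ.symm.toFun (x / 2 : ℕ) < 0)

theorem toArc_tau_even (σ : SignedPerm n) {i : ℕ} (h : 1 ≤ i ∧ i ≤ n) :
    σ.toArc.tau (2 * i) = 2 * (σ.toFun i).natAbs + 1 := by
  simp [toArc, h.1, h.2]

theorem toArc_tau_odd (σ : SignedPerm n) {i : ℕ} (h : 1 ≤ i ∧ i ≤ n) :
    σ.toArc.tau (2 * i + 1) = 2 * (σ.symm.toFun i).natAbs := by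
  have h1 : (2 * i + 1) / 2 = i := by omega
  have h2 : (2 * i + 1) % 2 ≠ 0 := by omega
  simp only [toArc, h1, h, if_true, if_neg h2, and_self]

theorem toArc_tau_of_not (σ : SignedPerm n) {x : ℕ} (h : ¬(1 ≤ x / 2 ∧ x / 2 ≤ n)) :
    σ.toArc.tau x = x := by
  simp only [toArc, if_neg h]

theorem toArc_eps_even (σ : SignedPerm n) (i : ℕ) :
    σ.toArc.eps (2 * i) = decide (σ.toFun i < 0) := by
  simp [toArc]

theorem toArc_eps_odd (σ : SignedPerm n) (i : ℕ) :
    σ.toArc.eps (2 * i + 1) = decide (σ.symm.toFun i < 0) := by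
  have h1 : (2 * i + 1) / 2 = i := by omega
  have h2 : (2 * i + 1) % 2 ≠ 0 := by omega
  simp only [toArc, h1, if_neg h2]

/-- Both ends of an arc carry the same sign. -/
theorem symm_toFun_neg_iff (σ : SignedPerm n) {i : ℕ} (hi : 1 ≤ i) :
    σ.symm.toFun (σ.toFun i).natAbs < 0 ↔ σ.toFun i < 0 := by
  rw [toFun_natAbs, symm_toFun]
  split_ifs <;> omega

theorem toArc_isComplete (σ : SignedPerm n) : σ.toArc.IsComplete (2 * n + 2) := by
  have cases : ∀ x : ℕ, ¬(1 ≤ x / 2 ∧ x / 2 ≤ n) ∨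
      ∃ i : ℕ, (1 ≤ i ∧ i ≤ n) ∧ (x = 2 * i ∨ x = 2 * i + 1) := by
    intro x
    by_cases h : 1 ≤ x / 2 ∧ x / 2 ≤ n
    · exact Or.inr ⟨x / 2, h, by omega⟩
    · exact Or.inl h
  have hn : ∀ i : ℕ, (1 ≤ i ∧ i ≤ n) → 1 ≤ (i : ℤ).natAbs ∧ (i : ℤ).natAbs ≤ n := fun i h => by
    rwa [Int.natAbs_natCast]
  have ho : ∀ x : ℕ, ¬(1 ≤ x / 2 ∧ x / 2 ≤ n) → σ.toArc.eps x = false := by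
    intro x h
    have h' : ¬(1 ≤ ((x / 2 : ℕ) : ℤ).natAbs ∧ ((x / 2 : ℕ) : ℤ).natAbs ≤ n) := by
      rwa [Int.natAbs_natCast]
    simp only [toArc, toFun_of_not _ h']
    split_ifs <;> simp only [decide_eq_false_iff_not] <;> omega
  refine ⟨⟨fun x => ?_, fun x hx => ?_, fun x hx => ?_, fun x hx => ?_, fun x => ?_,
    fun x hx => ?_, fun x hx => ?_⟩, fun x h2 hx => ?_⟩
  · rcases cases x with h | ⟨i, h, rfl | rfl⟩
    · rw [toArc_tau_of_not σ h, toArc_tau_of_not σ h]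
    · rw [toArc_tau_even σ h, toArc_tau_odd σ (natAbs_toFun σ (hn i h)), natAbs_toFun_natAbs,
        symm_toFun, Int.natAbs_natCast]
    · have := symm_toFun σ.symm
      rw [symm_symm] at this
      rw [toArc_tau_odd σ h, toArc_tau_even σ (natAbs_toFun σ.symm (hn i h)), natAbs_toFun_natAbs,
        this, Int.natAbs_natCast]
  · exact toArc_tau_of_not σ (by omega)
  · exact toArc_tau_of_not σ (by omega)
  · rcases cases x with h | ⟨i, h, rfl | rfl⟩
    · exact absurd (toArc_tau_of_not σ h) hx
    · rw [toArc_tau_even σ h]; omega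
    · rw [toArc_tau_odd σ h]; omega
  · rcases cases x with h | ⟨i, h, rfl | rfl⟩
    · rw [toArc_tau_of_not σ h]
    · rw [toArc_tau_even σ h, toArc_eps_odd, toArc_eps_even, decide_eq_decide]
      exact symm_toFun_neg_iff σ h.1
    · rw [toArc_tau_odd σ h, toArc_eps_odd, toArc_eps_even, decide_eq_decide]
      exact symm_toFun_neg_iff σ.symm h.1
  · exact ho x (by omega)
  · exact ho x (by omega)
  · rcases cases x with h | ⟨i, h, rfl | rfl⟩
    · omega
    · rw [toArc_tau_even σ h]; omega
    · rw [toArc_tau_odd σ h]; omega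

theorem toArc_injective : Function.Injective (toArc : SignedPerm n → ArcDiagram) := by
  intro σ τ h
  have key : ∀ i : ℕ, σ.toFun i = τ.toFun i := by
    intro i
    by_cases hi : 1 ≤ i ∧ i ≤ n
    · have h1 := congrFun (congrArg ArcDiagram.tau h) (2 * i)
      have h2 := congrFun (congrArg ArcDiagram.eps h) (2 * i)
      rw [toArc_tau_even _ hi, toArc_tau_even _ hi] at h1
      rw [toArc_eps_even, toArc_eps_even, decide_eq_decide] at h2
      omega
    · rw [toFun_of_not, toFun_of_not] <;> rwa [Int.natAbs_natCast]
  refine toFun_injective (funext fun z => ?_)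
  obtain ⟨m, rfl | rfl⟩ := Int.eq_nat_or_neg z
  · exact key m
  · rw [toFun_neg, toFun_neg, key]

/-- The signed value that an arc diagram puts at `z`, where `z > 0` is represented by the point
`2 z + r`. -/
def arcVal (P : ArcDiagram) (r : ℕ) (z : ℤ) : ℤ :=
  if P.eps (2 * z.natAbs + r) = decide (z < 0) then ((P.tau (2 * z.natAbs + r) / 2 : ℕ) : ℤ)
  else -((P.tau (2 * z.natAbs + r) / 2 : ℕ) : ℤ)

theorem natAbs_arcVal (P : ArcDiagram) (r : ℕ) (z : ℤ) :
    (arcVal P r z).natAbs = P.tau (2 * z.natAbs + r) / 2 := by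
  unfold arcVal; split_ifs <;> omega

theorem arcVal_mem {P : ArcDiagram} (hP : P.IsComplete (2 * n + 2)) {r : ℕ} (hr : r < 2) {z : ℤ}
    (hz : z ∈ (Finset.Icc (-(n : ℤ)) (n : ℤ)).erase 0) :
    arcVal P r z ∈ (Finset.Icc (-(n : ℤ)) (n : ℤ)).erase 0 := by
  rw [mem_iff] at hz ⊢
  rw [natAbs_arcVal]
  have h1 := hP.tau_lt_of_lt (y := 2 * z.natAbs + r) (by omega)
  have h2 := hP.two_le_tau (y := 2 * z.natAbs + r) (by omega)
  omega

theorem arcVal_neg (P : ArcDiagram) (r : ℕ) {z : ℤ} (hz : z ≠ 0) :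
    arcVal P r (-z) = -arcVal P r z := by
  unfold arcVal
  have : decide (-z < 0) = !decide (z < 0) := by
    rw [← decide_not, decide_eq_decide]; omega
  rw [Int.natAbs_neg, this]
  cases decide (z < 0) <;> cases P.eps (2 * z.natAbs + r) <;> simp

/-- Absolute values return because `tau` is a parity-reversing involution, signs because `eps`
agrees at both ends. The condition `r + t = 1` covers both composites of the future permutation and
its inverse. -/
theorem arcVal_arcVal {P : ArcDiagram} (hP : P.IsComplete (2 * n + 2)) {r t : ℕ} (hr : r + t = 1)
    {z : ℤ} (hz : z ∈ (Finset.Icc (-(n : ℤ)) (n : ℤ)).erase 0) :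
    arcVal P t (arcVal P r z) = z := by
  have hm := arcVal_mem hP (show r < 2 by omega) hz
  rw [mem_iff] at hz hm
  have ho := hP.odd _ (hP.tau_ne (2 * z.natAbs + r) (by omega) (by omega))
  have ht : 2 * (arcVal P r z).natAbs + t = P.tau (2 * z.natAbs + r) := by
    rw [natAbs_arcVal]; omega
  have hs : decide (arcVal P r z < 0) = decide (P.eps (2 * z.natAbs + r) ≠ decide (z < 0)) := by
    rw [natAbs_arcVal] at hm
    rw [decide_eq_decide]
    unfold arcVal
    split_ifs with h <;> simp only [h, ne_eq, not_true, not_false_iff, iff_true, iff_false] <;>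
      omega
  rw [arcVal, ht, hP.invol, hP.eps_tau, hs,
    show (2 * z.natAbs + r) / 2 = z.natAbs by omega]
  by_cases h : z < 0 <;> cases P.eps (2 * z.natAbs + r) <;>
    simp only [h, decide_true, decide_false, ne_eq, not_true, not_false_iff, reduceCtorEq,
      if_true, if_false] <;> omega

theorem exists_toArc_eq {P : ArcDiagram} (hP : P.IsComplete (2 * n + 2)) :
    ∃ σ : SignedPerm n, σ.toArc = P := by
  let σ : SignedPerm n := ⟨⟨fun z => ⟨arcVal P 0 z.1, arcVal_mem hP (by omega) z.2⟩,
    fun z => ⟨arcVal P 1 z.1, arcVal_mem hP (by omega) z.2⟩,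
    fun z => Subtype.ext (arcVal_arcVal hP rfl z.2),
    fun z => Subtype.ext (arcVal_arcVal hP rfl z.2)⟩,
    fun z => Subtype.ext (arcVal_neg P 0 (Finset.mem_erase.1 z.2).1)⟩
  have h0 : ∀ i : ℕ, 1 ≤ i ∧ i ≤ n → σ.toFun i = arcVal P 0 i := fun i h => by
    rw [toFun, dif_pos ((mem_iff _).2 (by rwa [Int.natAbs_natCast]))]; rfl
  have h1 : ∀ i : ℕ, 1 ≤ i ∧ i ≤ n → σ.symm.toFun i = arcVal P 1 i := fun i h => by
    rw [toFun, dif_pos ((mem_iff _).2 (by rwa [Int.natAbs_natCast]))]; rfl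
  have hneg : ∀ (r i : ℕ), r < 2 → 1 ≤ i ∧ i ≤ n →
      (arcVal P r i < 0 ↔ P.eps (2 * i + r) = true) := fun r i hr h => by
    have := natAbs_arcVal P r i
    rw [Int.natAbs_natCast] at this
    have := hP.two_le_tau (y := 2 * i + r) (by omega)
    have hi : ¬((i : ℤ) < 0) := by omega
    simp only [arcVal, Int.natAbs_natCast, hi]
    cases P.eps (2 * i + r) <;> simp <;> omega
  refine ⟨σ, ArcDiagram.ext (funext fun x => ?_) (funext fun x => ?_)⟩
  · by_cases h : 1 ≤ x / 2 ∧ x / 2 ≤ n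
    · rcases Nat.even_or_odd' x with ⟨i, rfl | rfl⟩
      · have hi : 1 ≤ i ∧ i ≤ n := by omega
        have ho := hP.odd _ (hP.tau_ne (2 * i) (by omega) (by omega))
        rw [toArc_tau_even σ hi, h0 i hi, natAbs_arcVal, Int.natAbs_natCast, add_zero]
        omega
      · have hi : 1 ≤ i ∧ i ≤ n := by omega
        have ho := hP.odd _ (hP.tau_ne (2 * i + 1) (by omega) (by omega))
        rw [toArc_tau_odd σ hi, h1 i hi, natAbs_arcVal, Int.natAbs_natCast]
        omega
    · rw [toArc_tau_of_not σ h]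
      rcases (show x < 2 ∨ 2 * n + 2 ≤ x by omega) with h | h
      · rw [hP.tau_lt x h]
      · rw [hP.tau_ge x h]
  · by_cases h : 1 ≤ x / 2 ∧ x / 2 ≤ n
    · rcases Nat.even_or_odd' x with ⟨i, rfl | rfl⟩
      · have hi : 1 ≤ i ∧ i ≤ n := by omega
        rw [toArc_eps_even, h0 i hi, Bool.eq_iff_iff, decide_eq_true_iff, hneg 0 i (by omega) hi,
          add_zero]
      · have hi : 1 ≤ i ∧ i ≤ n := by omega
        rw [toArc_eps_odd, h1 i hi, Bool.eq_iff_iff, decide_eq_true_iff, hneg 1 i (by omega) hi]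
    · have hσ := σ.toArc_isComplete.toIsPartial
      rcases (show x < 2 ∨ 2 * n + 2 ≤ x by omega) with h | h
      · rw [hP.eps_lt x h, hσ.eps_lt x h]
      · rw [hP.eps_ge x h, hσ.eps_ge x h]

end SignedPerm

/-! ### Reading off the statistics from the weights -/

namespace ArcDiagram

/-- The condition for a point `y` to contribute a power of `q` to the weight of the point `x`;
here `tx`, `ty` are the other ends and `ex`, `ey` the signs. -/
abbrev Contributes (x tx : ℕ) (ex : Bool) (y ty : ℕ) (ey : Bool) : Prop :=
  y < x ∧ x ≤ ty ∧ y % 2 ≠ x % 2 ∧ ((x ≤ tx ∧ ex = true) ∨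
    (tx < x ∧ (if ex then -(tx : ℤ) else tx) < (if ey then -(y : ℤ) else y)))

section Weight

variable {R : Type*} [CommRing R] {N : ℕ} {P : ArcDiagram}

/-- The number of points that contribute a power of `q` to the weight of `x`. -/
def qExponent (N : ℕ) (P : ArcDiagram) (x : ℕ) : ℕ :=
  ∑ y ∈ Finset.Ico 2 N,
    if Contributes x (P.tau x) (P.eps x) y (P.tau y) (P.eps y) then 1 else 0

theorem IsComplete.weight_eq (hP : P.IsComplete N) (q s : R) {x : ℕ} (hx : x < N)
    (hfix : ¬(x % 2 = 1 ∧ P.tau x + 1 = x ∧ P.eps x = false)) :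
    weight q s x P = C s ^ (if x % 2 = 0 ∧ x ≤ P.tau x ∧ P.eps x = false then 1 else 0) *
      X ^ (if x ≤ P.tau x ∧ P.eps x = true then 1 else 0) * C q ^ qExponent N P x := by
  -- A complete diagram has no fixed points in its range, so being loose at `x` means being joined
  -- to a point at or beyond `x`.
  have hl : ∀ y, y ∈ P.looseMod x ((x + 1) % 2) ↔
      y ∈ Finset.Ico 2 N ∧ (y < x ∧ x ≤ P.tau y ∧ y % 2 ≠ x % 2) := fun y => by
    rw [mem_looseMod, Finset.mem_Ico]
    have := hP.tau_ne y
    omega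
  unfold weight
  rw [qExponent, Finset.sum_boole, Nat.cast_id]
  unfold Contributes
  by_cases h : x ≤ P.tau x
  · cases he : P.eps x
    · rw [Finset.filter_false_of_mem]
      · by_cases hx2 : x % 2 = 0 <;> simp [h, hx2]
      · rintro y - ⟨_, _, _, h1 | h1⟩
        · simp at h1
        · omega
    · have : Finset.filter (fun y => y < x ∧ x ≤ P.tau y ∧ y % 2 ≠ x % 2 ∧
          ((x ≤ P.tau x ∧ true = true) ∨ (P.tau x < x ∧ (if true then -(P.tau x : ℤ) else P.tau x) <
            (if P.eps y then -(y : ℤ) else y)))) (Finset.Ico 2 N) =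
            P.looseMod x ((x + 1) % 2) := by
        ext y
        rw [Finset.mem_filter, hl]
        simp [h]
      rw [this]
      simp [h]
  · rw [if_neg h, if_neg hfix, if_neg (by omega), if_neg (by omega), pow_zero, pow_zero, one_mul,
      one_mul, map_pow]
    congr 2
    ext y
    rw [above, Finset.mem_filter, hl, Finset.mem_filter]
    simp only [height, hP.eps_tau, h, false_and, false_or, show P.tau x < x by omega, true_and]
    tauto

end Weight

end ArcDiagram

namespace SignedPerm

variable {n : ℕ}

/-- Groups the points by arcs, reindexing the odd ones along `i ↦ |σ_i|`. -/
theorem sum_Ico_toArc {M : Type*} [AddCommMonoid M] (σ : SignedPerm n) (f : ℕ → M) :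
    ∑ x ∈ Finset.Ico 2 (2 * n + 2), f x =
      ∑ i ∈ Finset.Icc 1 n, (f (2 * i) + f (2 * (σ.toFun i).natAbs + 1)) := by
  have h1 : ∑ x ∈ Finset.Ico 2 (2 * n + 2), f x =
      ∑ i ∈ Finset.Icc 1 n, (f (2 * i) + f (2 * i + 1)) := by
    clear σ
    induction n with
    | zero => simp
    | succ n ih =>
      rw [Finset.sum_Icc_succ_top (by omega), ← ih, show 2 * (n + 1) + 2 = 2 * n + 2 + 1 + 1 by omega,
        Finset.sum_Ico_succ_top (by omega), Finset.sum_Ico_succ_top (by omega), add_assoc]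
      rfl
  rw [h1, Finset.sum_add_distrib, Finset.sum_add_distrib]
  congr 1
  symm
  have hmem : ∀ (τ : SignedPerm n) (i : ℕ), i ∈ Finset.Icc 1 n →
      (τ.toFun i).natAbs ∈ Finset.Icc 1 n := fun τ i hi => by
    rw [Finset.mem_Icc] at hi ⊢
    exact natAbs_toFun τ (by rwa [Int.natAbs_natCast])
  refine Finset.sum_nbij' (fun i : ℕ => (σ.toFun i).natAbs) (fun i : ℕ => (σ.symm.toFun i).natAbs)
    (hmem σ) (hmem σ.symm) (fun i _ => ?_) (fun i _ => ?_) (fun i _ => rfl)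
  · rw [natAbs_toFun_natAbs, symm_toFun, Int.natAbs_natCast]
  · have := symm_toFun σ.symm
    rw [symm_symm] at this
    rw [natAbs_toFun_natAbs, this, Int.natAbs_natCast]

theorem sum_PM (f : ℤ → ℕ) :
    ∑ i : PM n, (if 0 < i.1 then f i.1 else 0) = ∑ i ∈ Finset.Icc 1 n, f i := by
  rw [← Finset.sum_filter]
  refine Finset.sum_bij' (fun i _ => i.1.toNat)
    (fun i hi => ⟨(i : ℤ), by rw [mem_iff]; rw [Finset.mem_Icc] at hi; omega⟩) ?_ ?_ ?_ ?_ ?_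
  · intro i hi
    have h1 := (mem_iff i.1).1 i.2
    have h2 := (Finset.mem_filter.1 hi).2
    rw [Finset.mem_Icc]
    omega
  · intro i hi
    rw [Finset.mem_Icc] at hi
    rw [Finset.mem_filter]
    exact ⟨Finset.mem_univ _, by simp only; omega⟩
  · intro i hi
    have h2 := (Finset.mem_filter.1 hi).2
    exact Subtype.ext (by simp only; omega)
  · intro i _
    simp
  · intro i hi
    have h2 := (Finset.mem_filter.1 hi).2
    congr 1
    omega

theorem neg_eq_sum (σ : SignedPerm n) :
    σ.neg = ∑ i ∈ Finset.Icc 1 n, if σ.toFun i < 0 then 1 else 0 := by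
  rw [← sum_PM fun z => if σ.toFun z < 0 then 1 else 0, neg, Finset.card_filter]
  simp only [toFun_coe, ite_and]

theorem wex_eq_sum (σ : SignedPerm n) :
    σ.wex = ∑ i ∈ Finset.Icc 1 n, if (i : ℤ) ≤ σ.toFun i then 1 else 0 := by
  rw [← sum_PM fun z => if z ≤ σ.toFun z then 1 else 0, wex, Finset.card_filter]
  simp only [toFun_coe, ite_and]

/-- The condition for `(i, j)` to be a crossing of a signed permutation with values `v` at `i` and
`w` at `j`. -/
abbrev CrossingAt (i v j w : ℤ) : Prop :=
  (i < j ∧ j ≤ v ∧ v < w) ∨ (-i < j ∧ j ≤ -v ∧ -v < w) ∨ (i > j ∧ j > v ∧ v > w)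

theorem cro_eq_sum (σ : SignedPerm n) :
    σ.cro = ∑ i ∈ Finset.Icc 1 n, ∑ j ∈ Finset.Icc 1 n,
      if CrossingAt i (σ.toFun i) j (σ.toFun j) then 1 else 0 := by
  have h : ∀ i : ℤ, ∑ j ∈ Finset.Icc 1 n,
      (if CrossingAt i (σ.toFun i) j (σ.toFun j) then 1 else 0) =
      ∑ j : PM n, (if 0 < j.1 then
        if CrossingAt i (σ.toFun i) j.1 (σ.toFun j.1) then 1 else 0 else 0) := fun i =>
    (sum_PM fun z => if CrossingAt i (σ.toFun i) z (σ.toFun z) then 1 else 0).symm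
  simp only [h]
  rw [← sum_PM fun z => ∑ j : PM n, (if 0 < j.1 then
        if CrossingAt z (σ.toFun z) j.1 (σ.toFun j.1) then 1 else 0 else 0), cro,
    Finset.card_filter, Fintype.sum_prod_type]
  refine Finset.sum_congr rfl fun i _ => ?_
  split_ifs with hi
  · refine Finset.sum_congr rfl fun j _ => ?_
    rw [← ite_and]
    refine if_congr ?_ rfl rfl
    simp only [IsCrossing, CrossingAt, toFun_coe, hi, true_and]
  · simp [IsCrossing, hi]

/-- The contributions of the ends of one arc to the weights of the ends of another one. -/
def arcContribution (i j : ℕ) (v w : ℤ) : ℕ :=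
  (if ArcDiagram.Contributes (2 * i) (2 * v.natAbs + 1) (decide (v < 0)) (2 * w.natAbs + 1) (2 * j)
    (decide (w < 0)) then 1 else 0) +
  (if ArcDiagram.Contributes (2 * v.natAbs + 1) (2 * i) (decide (v < 0)) (2 * j) (2 * w.natAbs + 1)
    (decide (w < 0)) then 1 else 0)

theorem arcContribution_self {i : ℕ} {v : ℤ} : arcContribution i i v v = 0 := by
  unfold arcContribution
  rw [if_neg, if_neg] <;> omega

/-- The two counts may attach a crossing to opposite orders of the pair, as happens for `i > j > σ_i
> σ_j`, so they are compared after symmetrization. Each of the four sign patterns is linear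
arithmetic. -/
theorem arcContribution_add_comm_of_lt {i j : ℕ} {v w : ℤ} (hv : v ≠ 0) (hw : w ≠ 0)
    (h : i < j) (hvw : v.natAbs ≠ w.natAbs) :
    arcContribution i j v w + arcContribution j i w v =
      (if CrossingAt i v j w then 1 else 0) + (if CrossingAt j w i v then 1 else 0) := by
  have e1 : ∀ a b : ℕ, (2 * a + 1) % 2 ≠ 2 * b % 2 := by omega
  have e2 : ∀ a b : ℕ, 2 * a % 2 ≠ (2 * b + 1) % 2 := by omega
  unfold arcContribution
  obtain ⟨a, rfl | rfl⟩ := Int.eq_nat_or_neg v <;> obtain ⟨b, rfl | rfl⟩ := Int.eq_nat_or_neg w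
  all_goals
    simp only [Int.natAbs_neg, Int.natAbs_natCast, ne_eq, Int.natCast_eq_zero, neg_eq_zero]
      at hvw hv hw ⊢
    have ha : ¬(a : ℤ) < 0 := by omega
    have hb : ¬(b : ℤ) < 0 := by omega
    have ha' : -(a : ℤ) < 0 := by omega
    have hb' : -(b : ℤ) < 0 := by omega
    simp only [ArcDiagram.Contributes, CrossingAt, ha, hb, ha', hb', decide_true, decide_false,
      if_true, if_false, and_true, and_false, false_or, Bool.false_eq_true, e1, e2, true_and, ne_eq,
      not_false_iff]
    split_ifs <;> omega

theorem toArc_tau_value (σ : SignedPerm n) {i : ℕ} (h : 1 ≤ i ∧ i ≤ n) :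
    σ.toArc.tau (2 * (σ.toFun i).natAbs + 1) = 2 * i := by
  rw [← toArc_tau_even σ h, σ.toArc_isComplete.invol]

theorem toArc_eps_value (σ : SignedPerm n) {i : ℕ} (h : 1 ≤ i ∧ i ≤ n) :
    σ.toArc.eps (2 * (σ.toFun i).natAbs + 1) = decide (σ.toFun i < 0) := by
  rw [← toArc_tau_even σ h, σ.toArc_isComplete.eps_tau, toArc_eps_even]

theorem sum_sum_eq_of_symm {ι : Type*} (s : Finset ι) (f g : ι → ι → ℕ)
    (h : ∀ i ∈ s, ∀ j ∈ s, f i j + f j i = g i j + g j i) :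
    ∑ i ∈ s, ∑ j ∈ s, f i j = ∑ i ∈ s, ∑ j ∈ s, g i j := by
  have h1 : ∑ i ∈ s, ∑ j ∈ s, (f i j + f j i) = ∑ i ∈ s, ∑ j ∈ s, (g i j + g j i) :=
    Finset.sum_congr rfl fun i hi => Finset.sum_congr rfl fun j hj => h i hi j hj
  simp only [Finset.sum_add_distrib] at h1
  rw [Finset.sum_comm (f := fun i j => f j i), Finset.sum_comm (f := fun i j => g j i)] at h1
  omega

theorem sum_qExponent (σ : SignedPerm n) :
    ∑ x ∈ Finset.Ico 2 (2 * n + 2), σ.toArc.qExponent (2 * n + 2) x = σ.cro := by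
  have h1 : ∑ x ∈ Finset.Ico 2 (2 * n + 2), σ.toArc.qExponent (2 * n + 2) x =
      ∑ i ∈ Finset.Icc 1 n, ∑ j ∈ Finset.Icc 1 n,
        arcContribution i j (σ.toFun i) (σ.toFun j) := by
    rw [sum_Ico_toArc σ]
    refine Finset.sum_congr rfl fun i hi => ?_
    rw [ArcDiagram.qExponent, ArcDiagram.qExponent, sum_Ico_toArc σ, sum_Ico_toArc σ,
      ← Finset.sum_add_distrib]
    refine Finset.sum_congr rfl fun j hj => ?_
    rw [Finset.mem_Icc] at hi hj
    rw [toArc_tau_value σ hi, toArc_tau_value σ hj, toArc_eps_value σ hi, toArc_eps_value σ hj,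
      toArc_tau_even σ hi, toArc_tau_even σ hj, toArc_eps_even, toArc_eps_even, arcContribution,
      if_neg (c := ArcDiagram.Contributes (2 * i) _ _ (2 * j) _ _) (by omega),
      if_neg (c := ArcDiagram.Contributes (2 * (σ.toFun i).natAbs + 1) _ _
        (2 * (σ.toFun j).natAbs + 1) _ _) (by omega), zero_add, add_zero]
  rw [h1, cro_eq_sum]
  refine sum_sum_eq_of_symm _ _ _ fun i hi j hj => ?_
  rw [Finset.mem_Icc] at hi hj
  have hv := toFun_ne_zero σ (z := i) (by omega)
  have hw := toFun_ne_zero σ (z := j) (by omega)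
  have hne : i ≠ j → (σ.toFun i).natAbs ≠ (σ.toFun j).natAbs := fun h h' => h (by
    have := congrArg (fun m : ℕ => σ.toArc.tau (2 * m + 1)) h'
    simp only [toArc_tau_value σ hi, toArc_tau_value σ hj] at this
    omega)
  rcases lt_trichotomy i j with h | rfl | h
  · exact arcContribution_add_comm_of_lt hv hw h (hne h.ne)
  · rw [arcContribution_self, if_neg (by unfold CrossingAt; omega)]
  · rw [add_comm, arcContribution_add_comm_of_lt hw hv h (hne h.ne').symm, add_comm]

theorem mem_Bstar_iff (σ : SignedPerm n) :
    σ ∈ Bstar n ↔ ∀ i : ℕ, 1 ≤ i ∧ i ≤ n → σ.toFun i ≠ i := by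
  rw [Bstar, Finset.mem_filter]
  constructor
  · rintro ⟨-, h⟩ i hi
    have := h ⟨(i : ℤ), by rw [mem_iff]; omega⟩ (by simp only; omega)
    rwa [← toFun_coe] at this
  · refine fun h => ⟨Finset.mem_univ _, fun i hi => ?_⟩
    have h1 := (mem_iff i.1).1 i.2
    have := h i.1.natAbs h1
    rwa [show ((i.1.natAbs : ℕ) : ℤ) = i.1 by omega, toFun_coe] at this

theorem prod_weight {R : Type*} [CommRing R] (q s : R) (σ : SignedPerm n) :
    ∏ x ∈ Finset.Ico 2 (2 * n + 2), ArcDiagram.weight q s x σ.toArc =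
      if σ ∈ Bstar n then C s ^ σ.wex * X ^ σ.neg * C q ^ σ.cro else 0 := by
  have hfix : ∀ i : ℕ, σ.symm.toFun i = i ↔ σ.toFun i = i := fun i => by
    have h1 := symm_toFun σ i
    have h2 := symm_toFun σ.symm i
    rw [symm_symm] at h2
    constructor <;> intro h
    · rwa [h] at h2
    · rwa [h] at h1
  split_ifs with h <;> rw [mem_Bstar_iff] at h
  · rw [Finset.prod_congr rfl fun x hx => σ.toArc_isComplete.weight_eq q s
        (Finset.mem_Ico.1 hx).2 ?_, Finset.prod_mul_distrib, Finset.prod_mul_distrib,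
      Finset.prod_pow_eq_pow_sum, Finset.prod_pow_eq_pow_sum, Finset.prod_pow_eq_pow_sum,
      sum_qExponent, wex_eq_sum, neg_eq_sum, sum_Ico_toArc σ, sum_Ico_toArc σ]
    · congr 3 <;> refine Finset.sum_congr rfl fun i hi => ?_ <;> rw [Finset.mem_Icc] at hi <;>
        rw [toArc_tau_value σ hi, toArc_eps_value σ hi, toArc_tau_even σ hi, toArc_eps_even]
      · rw [if_neg (c := (2 * (σ.toFun i).natAbs + 1) % 2 = 0 ∧ _) (by omega), add_zero]
        refine if_congr ?_ rfl rfl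
        rw [decide_eq_false_iff_not]
        omega
      · simp only [decide_eq_true_eq]
        split_ifs <;> omega
    · rintro ⟨h1, h2, h3⟩
      rw [Finset.mem_Ico] at hx
      obtain ⟨i, rfl⟩ : ∃ i, x = 2 * i + 1 := ⟨x / 2, by omega⟩
      have hi : 1 ≤ i ∧ i ≤ n := by omega
      rw [toArc_tau_odd σ hi] at h2
      rw [toArc_eps_odd, decide_eq_false_iff_not] at h3
      exact h i hi ((hfix i).1 (by omega))
  · push Not at h
    obtain ⟨i, hi, h⟩ := h
    have h := (hfix i).2 h
    refine Finset.prod_eq_zero (i := 2 * i + 1) (Finset.mem_Ico.2 (by omega)) ?_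
    rw [ArcDiagram.weight, toArc_tau_odd σ hi, toArc_eps_odd, h, Int.natAbs_natCast,
      if_neg (by omega), if_pos ⟨by omega, rfl, by simp⟩]

theorem sum_Bstar {R : Type*} [CommRing R] (q s : R) (hs : q * s = -1) (n : ℕ) :
    ∑ σ ∈ Bstar n, (C s ^ σ.wex * X ^ σ.neg * C q ^ σ.cro : R[X]) = (scaledOp q s ^ n) 1 := by
  classical
  rw [← ArcDiagram.sum_prod_weight q s hs n
    (Ω := (Finset.univ : Finset (SignedPerm n)).image toArc) fun P => ?_]
  · rw [Finset.sum_image fun _ _ _ _ h => toArc_injective h]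
    simp only [prod_weight]
    rw [← Finset.sum_filter, Finset.filter_mem_eq_inter, Finset.univ_inter]
  · rw [Finset.mem_image]
    constructor
    · rintro ⟨σ, -, rfl⟩
      exact σ.toArc_isComplete
    · intro hP
      obtain ⟨σ, h⟩ := exists_toArc_eq hP
      exact ⟨σ, Finset.mem_univ _, h⟩

end SignedPerm

/-! ### Parity of degrees and rescaling of monomials -/

section Parity

variable {R : Type*} [CommRing R]

/-- The polynomials all of whose monomials have degree of the same parity as `n`. -/
noncomputable def paritySubmodule (R : Type*) [CommRing R] (n : ℕ) : Submodule R R[X] :=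
  Submodule.span R {f | ∃ k, k % 2 = n % 2 ∧ f = monomial k 1}

/-- The linear map that multiplies `X ^ k` by `c k`. -/
noncomputable def scaleMonomials (c : ℕ → R) : R[X] →ₗ[R] R[X] :=
  Polynomial.lsum fun k => c k • Polynomial.monomial k

theorem scaleMonomials_monomial (c : ℕ → R) (k : ℕ) (a : R) :
    scaleMonomials c (monomial k a) = monomial k (c k * a) := by
  simp [scaleMonomials, Polynomial.lsum_apply, Polynomial.sum_monomial_index, smul_monomial]

theorem scaleMonomials_C_mul_X_pow_mul_C (c : ℕ → R) (k : ℕ) (a b : R) :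
    scaleMonomials c (C a * X ^ k * C b) = C (c k * a) * X ^ k * C b := by
  have h : ∀ d : R, C d * X ^ k * C b = monomial k (d * b) := fun d => by
    rw [← C_mul_X_pow_eq_monomial, C_mul]; ring
  rw [h, h, scaleMonomials_monomial, mul_assoc]

theorem scaledOp_monomial (q s : R) (k : ℕ) (a : R) :
    scaledOp q s (monomial k a) = monomial (k - 1) (s * (qNum q k * a)) +
      monomial (k + 1) (qNum q (k + 1) * a) := by
  rw [scaledOp_apply, ← qDeriv_X_mul, X_mul_monomial, qDeriv_monomial, qDeriv_monomial,
    C_mul_monomial, X_mul_monomial]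
  rfl

theorem scaledOp_mem (q s : R) {n : ℕ} {f : R[X]} (hf : f ∈ paritySubmodule R n) :
    scaledOp q s f ∈ paritySubmodule R (n + 1) := by
  have hm : ∀ k (a : R), k % 2 = (n + 1) % 2 → monomial k a ∈ paritySubmodule R (n + 1) := by
    intro k a hk
    rw [← mul_one a, ← smul_eq_mul, ← smul_monomial]
    exact Submodule.smul_mem _ _ (Submodule.subset_span ⟨k, hk, rfl⟩)
  induction hf using Submodule.span_induction with
  | mem f hf =>
    obtain ⟨k, hk, rfl⟩ := hf
    rw [scaledOp_monomial]
    refine Submodule.add_mem _ ?_ (hm _ _ (by omega))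
    cases k with
    | zero => simp
    | succ k => exact hm _ _ (by omega)
  | zero => simp
  | add f g _ _ hf hg => rw [map_add]; exact Submodule.add_mem _ hf hg
  | smul a f _ hf => rw [map_smul]; exact Submodule.smul_mem _ _ hf

theorem scaledOp_pow_mem (q s : R) (n : ℕ) : (scaledOp q s ^ n) 1 ∈ paritySubmodule R n := by
  induction n with
  | zero => exact Submodule.subset_span ⟨0, rfl, by simp⟩
  | succ n ih => rw [pow_succ', Module.End.mul_apply]; exact scaledOp_mem q s ih

theorem scaleMonomials_even (n : ℕ) {f : R[X]} (hf : f ∈ paritySubmodule R n) :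
    scaleMonomials (fun k => if Even k then 1 else 0) f = if Even n then f else 0 := by
  induction hf using Submodule.span_induction with
  | mem f hf =>
    obtain ⟨k, hk, rfl⟩ := hf
    have h : Even k ↔ Even n := by rw [Nat.even_iff, Nat.even_iff, hk]
    rw [scaleMonomials_monomial]
    by_cases hn : Even n <;> simp [h, hn]
  | zero => simp
  | add f g _ _ hf hg => rw [map_add, hf, hg]; split_ifs <;> simp
  | smul a f _ hf => rw [map_smul, hf]; split_ifs <;> simp

/-- For `k ≡ n` mod 2, both `s^⌊(k+1)/2⌋` and `s · s^⌊(k-1)/2⌋` (the latter for `k ≥ 1`) equal `s^(n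
mod 2) s^⌊k/2⌋`, so the rescaling absorbs the factor `s` of `D`. -/
theorem scaleMonomials_scaledOp (q s : R) (n : ℕ) {f : R[X]} (hf : f ∈ paritySubmodule R n) :
    scaleMonomials (fun k => s ^ (k / 2)) (scaledOp q s f) =
      s ^ (n % 2) • scaledOp q 1 (scaleMonomials (fun k => s ^ (k / 2)) f) := by
  induction hf using Submodule.span_induction with
  | mem f hf =>
    obtain ⟨k, hk, rfl⟩ := hf
    have e1 : s ^ ((k + 1) / 2) = s ^ (n % 2) * s ^ (k / 2) := by
      rw [← pow_add]; congr 1; omega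
    rw [scaledOp_monomial, map_add, scaleMonomials_monomial, scaleMonomials_monomial,
      scaleMonomials_monomial, scaledOp_monomial, smul_add, smul_monomial, smul_monomial, e1]
    congr 2
    · cases k with
      | zero => simp
      | succ k =>
        have e2 : s ^ (n % 2) * s ^ ((k + 1) / 2) = s * s ^ (k / 2) := by
          rw [← pow_add, ← pow_succ']; congr 1; omega
        rw [Nat.add_sub_cancel, smul_eq_mul]
        linear_combination -(qNum q (k + 1)) * e2
    · rw [smul_eq_mul]; ring
  | zero => simp
  | add f g _ _ hf hg => simp only [map_add, hf, hg, smul_add]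
  | smul a f _ hf => rw [map_smul, map_smul, hf, map_smul, map_smul, smul_comm]

theorem scaleMonomials_scaledOp_pow (q s : R) (n : ℕ) :
    scaleMonomials (fun k => s ^ (k / 2)) ((scaledOp q s ^ n) 1) =
      C (s ^ (n / 2)) * (scaledOp q 1 ^ n) 1 := by
  induction n with
  | zero =>
    rw [pow_zero, pow_zero, Module.End.one_apply, ← C_1, ← monomial_zero_left,
      scaleMonomials_monomial]
    simp
  | succ n ih =>
    rw [pow_succ', Module.End.mul_apply, scaleMonomials_scaledOp q s n (scaledOp_pow_mem q s n), ih,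
      pow_succ', Module.End.mul_apply, ← smul_eq_C_mul, ← smul_eq_C_mul, map_smul, smul_smul,
      ← pow_add]
    congr 2
    omega

theorem qPoly_eq (q : R) (n : ℕ) : qPoly q n = (scaledOp q 1 ^ n) 1 := by
  rw [qPoly, scaledOp, one_smul]

end Parity

theorem theorem1p4 {R : Type*} [CommRing R] (q : Rˣ) (n : ℕ) (hn : 1 ≤ n) :
    (∑ σ ∈ SignedPerm.Bstar n,
        C ((-((q⁻¹ : Rˣ) : R)) ^ (σ.fwex / 2)) * X ^ σ.neg * C ((q : R) ^ σ.cro)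
      = C ((-((q⁻¹ : Rˣ) : R)) ^ (n / 2)) * qPoly (q : R) n) ∧
    (∑ σ ∈ SignedPerm.Dstar n,
        C ((-((q⁻¹ : Rˣ) : R)) ^ (σ.fwex / 2)) * X ^ σ.neg * C ((q : R) ^ σ.cro)
      = if Even n then C ((-((q⁻¹ : Rˣ) : R)) ^ (n / 2)) * qPoly (q : R) n else 0) := by
  obtain ⟨s, hs⟩ : ∃ s : R, s = -((q⁻¹ : Rˣ) : R) := ⟨_, rfl⟩
  rw [← hs]
  have hB : ∑ σ ∈ SignedPerm.Bstar n, C (s ^ (σ.fwex / 2)) * X ^ σ.neg * C ((q : R) ^ σ.cro)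
      = C (s ^ (n / 2)) * qPoly (q : R) n := by
    rw [qPoly_eq, ← scaleMonomials_scaledOp_pow,
      ← SignedPerm.sum_Bstar (q : R) s (by rw [hs]; simp), map_sum]
    refine Finset.sum_congr rfl fun σ _ => ?_
    rw [← C_pow, ← C_pow, scaleMonomials_C_mul_X_pow_mul_C, ← pow_add, SignedPerm.fwex]
    -- `⌊(2 wex + neg)/2⌋ = wex + ⌊neg/2⌋`.
    congr 4
    omega
  refine ⟨hB, ?_⟩
  -- As `neg` is the degree in `t`, passing to `D_n^*` keeps the terms of even degree; all degrees
  -- on the right have the parity of `n`.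
  have hE : scaleMonomials (fun k => if Even k then 1 else 0) (C (s ^ (n / 2)) * qPoly (q : R) n) =
      if Even n then C (s ^ (n / 2)) * qPoly (q : R) n else 0 := by
    refine scaleMonomials_even n ?_
    rw [qPoly_eq, ← smul_eq_C_mul]
    exact Submodule.smul_mem _ _ (scaledOp_pow_mem _ _ n)
  rw [← hE, ← hB, map_sum, SignedPerm.Dstar, Finset.sum_filter]
  refine Finset.sum_congr rfl fun σ _ => ?_
  rw [scaleMonomials_C_mul_X_pow_mul_C]
  split_ifs <;> simp
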